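/- **Setting.** Let $(Z_i,Y_i)_{i\ge 1}$ be i.i.d. clusters with covariates $Z_i$ in a measurable space and square-integrable outcome vectors $Y_i\in\mathbb R^m$. Let $\mu(z,\theta)\in\mathbb R^m$, $\theta\in\mathbb R^p$, be a mean model with Jacobian $D(z,\theta)=\partial_\theta\mu(z,\theta)\in\mathbb R^{m\times p}$, and let $W(z,\theta)\in\mathbb R^{m\times m}$ be symmetric working matrices. The estimating function is $s(z,y,\theta)=D(z,\theta)^\top W(z,\theta)\{y-\mu(z,\theta)\}$. The outcomes have mean $\mu$, i.e. $\mathbb E[Y_i\mid Z_i]=\mu(Z_i,\theta_0)$ almost surely, and $\Sigma_i=\operatorname{Cov}(Y_i\mid Z_i)$ is their (arbitrary) true covariance. Write $D_i(\theta)=D(Z_i,\theta)$, $W_i(\theta)=W(Z_i,\theta)$ and $$J(\theta)=\mathbb E[D_i(\theta)^\top W_i(\theta)D_i(\theta)],\qquad K(\theta)=\mathbb E[D_i(\theta)^\top W_i(\theta)\Sigma_iW_i(\theta)D_i(\theta)].$$ Regularity: on an open neighbourhood $U$ of $\theta_0$, $\mu(z,\cdot)$ is $C^2$ and $W(z,\cdot)$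 is $C^1$ for every $z$, both are measurable in $z$, and $\|\partial_\theta s(z,y,\theta)\|\le G(z,y)$ for all $\theta\in U$ and some $G$ integrable under the law of $(Z_1,Y_1)$; the expectations $J(\theta_0)$ and $K(\theta_0)$ exist. For random vectors $X_n$ and $r_n\ge 0$, say that $X_n=O_p(r_n)$ *with constants* $C(\cdot)$ if for every $\varepsilon>0$, $\Pr(\|X_n\|>C(\varepsilon)r_n)\le\varepsilon$ for all large $n$; $O_p(r_n)$ means this for some function $C$. For a finite set $\mathcal X$ of size $k$, a law $Q>0$ on $\mathcal X$, a map $h:\mathcal X\to\mathbb R^d$ and $\alpha:\mathbb R^p\to\mathbb R^d$, let $P^*_{\theta_0}$ be the minimizer of $P\mapsto\sum_xP(x)\log\{P(x)/Q(x)\}$ over the laws $P>0$ on $\mathcal X$ with $\sum_xP(x)h(x)=\alpha(\theta_0)$ (when it exists), let $\mathsf T=\{v\in\mathbb R^k:\sum_xv_x=0,\ \sum_xv_xh(x)=0\}$, and let $H^*_{\theta_0}=V^\top\operatorname{diag}(1/P^*_{\theta_0})V$, where the columns of $V$ form an orthonormal basis of $\mathsf T$. Below $\dim\mathsf T=p$,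 so that $H^*_{\theta_0}$ is $p\times p$ like $J(\theta_0)$; $\preceq$ is the Loewner order and $\lambda_{\min}$ the smallest eigenvalue. **Theorem (GEE robustness).** Suppose that $\theta_0$ solves the population estimating equation $\mathbb E[s(Z_1,Y_1,\theta_0)]=0$ and that $\lambda_{\min}(J(\theta_0))>0$. Let $\hat\theta_n$ be any consistent root, that is, random vectors with $\hat\theta_n\to\theta_0$ in probability and $\Pr\big(\sum_{i=1}^ns(Z_i,Y_i,\hat\theta_n)=0\big)\to1$. Then: 1. $$\|\hat\theta_n-\theta_0\|=O_p\Big(\sqrt{\tfrac{\log n}{n\,\lambda_{\min}(J(\theta_0))}}\Big).$$ 2. The rate is preserved up to the factor $a^{-1/2}$ under comparable metrics. Precisely, there is a function $C(\cdot)$ such that part 1 holds with constants $C(\cdot)$ and, for every $H^*_{\theta_0}$ as above and all real $a>0$ and $b$ with $aH^*_{\theta_0}\preceq J(\theta_0)\preceq bH^*_{\theta_0}$, $$\sqrt{\tfrac{\log n}{n\,\lambda_{\min}(J(\theta_0))}}\le a^{-1/2}\sqrt{\tfrac{\log n}{n\,\lambda_{\min}(H^*_{\theta_0})}}\quad\text{for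 all }n\ge1,\qquad \|\hat\theta_n-\theta_0\|=O_p\Big(a^{-1/2}\sqrt{\tfrac{\log n}{n\,\lambda_{\min}(H^*_{\theta_0})}}\Big)$$ with the same constants $C(\cdot)$. 3. The matrix $J(\theta_0)^{-1}K(\theta_0)J(\theta_0)^{-1}$ is positive semidefinite and $$\sqrt n\,(\hat\theta_n-\theta_0)\ \xrightarrow{d}\ \mathcal N\big(0,\ J(\theta_0)^{-1}K(\theta_0)J(\theta_0)^{-1}\big).$$ -/

import Mathlib

open MeasureTheory ProbabilityTheory Filter Topology
open scoped Matrix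

/-- Smallest eigenvalue of a real symmetric matrix (the least element of its real spectrum). -/
noncomputable def lambdaMin {p : ℕ} (M : Matrix (Fin p) (Fin p) ℝ) : ℝ :=
  sInf (spectrum ℝ M)

/-- `X n = O_P(r n)` with constants `C`: for every `ε > 0`, for all large `n`,
`P(‖X n‖ > C ε * r n) ≤ ε`.  The usual `X n = O_P(r n)` is `∃ C, IsBigOInProbWith C P X r`. -/
def IsBigOInProbWith {Ω E : Type*} [MeasurableSpace Ω] [NormedAddCommGroup E]
    (C : ℝ → ℝ) (P : Measure Ω) (X : ℕ → Ω → E) (r : ℕ → ℝ) : Prop :=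
  ∀ ε : ℝ, 0 < ε → ∀ᶠ n in atTop, P {ω | C ε * r n < ‖X n ω‖} ≤ ENNReal.ofReal ε

namespace GEE

section

variable {𝓩 : Type*} {m p : ℕ}

/-- The Jacobian `D(z, θ)` of the mean of a cluster with covariates `z`; entry `(j, a)` is
`∂ μ_j(z, θ) / ∂ θ_a`. -/
noncomputable def jacobian (μ : 𝓩 → EuclideanSpace ℝ (Fin p) → EuclideanSpace ℝ (Fin m))
    (z : 𝓩) (θ : EuclideanSpace ℝ (Fin p)) : Matrix (Fin m) (Fin p) ℝ :=
  Matrix.of fun j a => fderiv ℝ (μ z) θ (EuclideanSpace.single a 1) j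

/-- The contribution `D(z, θ)ᵀ W(z, θ) (y - μ(z, θ))` of a cluster `x = (z, y)` to the estimating
equation. -/
noncomputable def score (μ : 𝓩 → EuclideanSpace ℝ (Fin p) → EuclideanSpace ℝ (Fin m))
    (W : 𝓩 → EuclideanSpace ℝ (Fin p) → Matrix (Fin m) (Fin m) ℝ)
    (x : 𝓩 × EuclideanSpace ℝ (Fin m)) (θ : EuclideanSpace ℝ (Fin p)) :
    EuclideanSpace ℝ (Fin p) :=
  WithLp.toLp 2
    (((jacobian μ x.1 θ)ᵀ * W x.1 θ) *ᵥ (WithLp.ofLp (x.2 - μ x.1 θ)))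

variable [MeasurableSpace 𝓩]

/-- The conditional expectation of a function of a cluster `x = (z, y)` given its covariates `z`,
under the law `ρ` of a cluster. -/
noncomputable def condZ (ρ : Measure (𝓩 × EuclideanSpace ℝ (Fin m)))
    (f : 𝓩 × EuclideanSpace ℝ (Fin m) → ℝ) : 𝓩 × EuclideanSpace ℝ (Fin m) → ℝ :=
  ρ[f | MeasurableSpace.comap Prod.fst inferInstance]

/-- The true covariance matrix `Σ = Cov(Y | Z)` of the outcomes of a cluster given its covariates. -/
noncomputable def trueCov (ρ : Measure (𝓩 × EuclideanSpace ℝ (Fin m)))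
    (x : 𝓩 × EuclideanSpace ℝ (Fin m)) : Matrix (Fin m) (Fin m) ℝ :=
  Matrix.of fun j l =>
    condZ ρ (fun x' => (x'.2 j - condZ ρ (fun x'' => x''.2 j) x') *
      (x'.2 l - condZ ρ (fun x'' => x''.2 l) x')) x

/-- The integrand `Dᵀ W D`. -/
noncomputable def breadIntegrand
    (μ : 𝓩 → EuclideanSpace ℝ (Fin p) → EuclideanSpace ℝ (Fin m))
    (W : 𝓩 → EuclideanSpace ℝ (Fin p) → Matrix (Fin m) (Fin m) ℝ)
    (θ : EuclideanSpace ℝ (Fin p)) (x : 𝓩 × EuclideanSpace ℝ (Fin m)) :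
    Matrix (Fin p) (Fin p) ℝ :=
  (jacobian μ x.1 θ)ᵀ * W x.1 θ * jacobian μ x.1 θ

/-- The integrand `Dᵀ W Σ W D`. -/
noncomputable def meatIntegrand (ρ : Measure (𝓩 × EuclideanSpace ℝ (Fin m)))
    (μ : 𝓩 → EuclideanSpace ℝ (Fin p) → EuclideanSpace ℝ (Fin m))
    (W : 𝓩 → EuclideanSpace ℝ (Fin p) → Matrix (Fin m) (Fin m) ℝ)
    (θ : EuclideanSpace ℝ (Fin p)) (x : 𝓩 × EuclideanSpace ℝ (Fin m)) :
    Matrix (Fin p) (Fin p) ℝ :=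
  (jacobian μ x.1 θ)ᵀ * W x.1 θ * trueCov ρ x * W x.1 θ * jacobian μ x.1 θ

/-- The effective curvature `J(θ) = E[Dᵀ W D]`. -/
noncomputable def J (ρ : Measure (𝓩 × EuclideanSpace ℝ (Fin m)))
    (μ : 𝓩 → EuclideanSpace ℝ (Fin p) → EuclideanSpace ℝ (Fin m))
    (W : 𝓩 → EuclideanSpace ℝ (Fin p) → Matrix (Fin m) (Fin m) ℝ)
    (θ : EuclideanSpace ℝ (Fin p)) : Matrix (Fin p) (Fin p) ℝ :=
  Matrix.of fun a b => ∫ x, breadIntegrand μ W θ x a b ∂ρ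

/-- The Godambe sandwich middle `K(θ) = E[Dᵀ W Σ W D]`. -/
noncomputable def K (ρ : Measure (𝓩 × EuclideanSpace ℝ (Fin m)))
    (μ : 𝓩 → EuclideanSpace ℝ (Fin p) → EuclideanSpace ℝ (Fin m))
    (W : 𝓩 → EuclideanSpace ℝ (Fin p) → Matrix (Fin m) (Fin m) ℝ)
    (θ : EuclideanSpace ℝ (Fin p)) : Matrix (Fin p) (Fin p) ℝ :=
  Matrix.of fun a b => ∫ x, meatIntegrand ρ μ W θ x a b ∂ρ

/-- The model together with the standing assumptions under which the estimating equation is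
studied near `θ₀`; `ρ` is the law of one cluster `(Z, Y)`. -/
structure Regular (ρ : Measure (𝓩 × EuclideanSpace ℝ (Fin m)))
    (μ : 𝓩 → EuclideanSpace ℝ (Fin p) → EuclideanSpace ℝ (Fin m))
    (W : 𝓩 → EuclideanSpace ℝ (Fin p) → Matrix (Fin m) (Fin m) ℝ)
    (θ₀ : EuclideanSpace ℝ (Fin p)) (U : Set (EuclideanSpace ℝ (Fin p))) : Prop where
  isOpen : IsOpen U
  mem : θ₀ ∈ U
  measurable_mean : ∀ θ ∈ U, Measurable fun z => μ z θ
  measurable_weight : ∀ θ ∈ U, ∀ j l, Measurable fun z => W z θ j l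
  contDiffOn_mean : ∀ z, ContDiffOn ℝ 2 (μ z) U
  contDiffOn_weight : ∀ z j l, ContDiffOn ℝ 1 (fun θ => W z θ j l) U
  symm_weight : ∀ z, ∀ θ ∈ U, (W z θ).IsSymm
  /-- The outcomes are square integrable. -/
  memLp : MemLp (fun x : 𝓩 × EuclideanSpace ℝ (Fin m) => x.2) 2 ρ
  /-- The outcomes of a cluster have (conditional) mean `μ(z, θ₀)`. -/
  mean : ∀ j, condZ ρ (fun x => x.2 j) =ᵐ[ρ] fun x => μ x.1 θ₀ j
  /-- The expectation defining `J(θ₀)` exists. -/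
  integrable_J : ∀ a b, Integrable (fun x => breadIntegrand μ W θ₀ x a b) ρ
  /-- The expectation defining `K(θ₀)` exists. -/
  integrable_K : ∀ a b, Integrable (fun x => meatIntegrand ρ μ W θ₀ x a b) ρ
  /-- The derivative of the estimating function is dominated on `U`. -/
  dominated : ∃ G : 𝓩 × EuclideanSpace ℝ (Fin m) → ℝ, Integrable G ρ ∧
    ∀ x, ∀ θ ∈ U, ‖fderiv ℝ (score μ W x) θ‖ ≤ G x

end

end GEE

namespace InfoGeom

variable {k d : ℕ}

/-- The laws `P` in the open simplex with `E_P[h] = c`. -/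
def feasible (h : Fin k → EuclideanSpace ℝ (Fin d)) (c : EuclideanSpace ℝ (Fin d)) :
    Set (Fin k → ℝ) :=
  {P | (∀ x, 0 < P x) ∧ ∑ x, P x = 1 ∧ ∑ x, P x • h x = c}

/-- Kullback-Leibler divergence between two positive laws on a finite set. -/
noncomputable def kl (P Q : Fin k → ℝ) : ℝ :=
  ∑ x, P x * Real.log (P x / Q x)

/-- `P` is the information projection of `Q` onto the laws with `E_P[h] = c`. -/
def IsInfoProjection (Q : Fin k → ℝ) (h : Fin k → EuclideanSpace ℝ (Fin d))
    (c : EuclideanSpace ℝ (Fin d)) (P : Fin k → ℝ) : Prop :=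
  P ∈ feasible h c ∧ IsMinOn (fun P' => kl P' Q) (feasible h c) P

/-- The tangent space `{v : 1ᵀ v = 0, A v = 0}` of the constraint manifold, `A = [h(1) ... h(k)]`. -/
def tangent (h : Fin k → EuclideanSpace ℝ (Fin d)) :
    Submodule ℝ (EuclideanSpace ℝ (Fin k)) where
  carrier := {v | ∑ x, v x = 0 ∧ ∑ x, v x • h x = 0}
  add_mem' := by
    rintro v w ⟨hv, hv'⟩ ⟨hw, hw'⟩
    constructor
    · simp [Finset.sum_add_distrib, hv, hw]
    · simp [Finset.sum_add_distrib, add_smul, hv', hw']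
  zero_mem' := by simp
  smul_mem' := by
    rintro c v ⟨hv, hv'⟩
    constructor
    · simp [← Finset.mul_sum, hv]
    · simp [mul_smul, ← Finset.smul_sum, hv']

/-- The projected Hessian `H* = Vᵀ diag(1 / P*) V` in an orthonormal basis `V` of the tangent
space. -/
noncomputable def hessian {p : ℕ} {h : Fin k → EuclideanSpace ℝ (Fin d)}
    (V : OrthonormalBasis (Fin p) ℝ (tangent h)) (Pstar : Fin k → ℝ) :
    Matrix (Fin p) (Fin p) ℝ :=
  let B : Matrix (Fin k) (Fin p) ℝ := Matrix.of fun x a => (V a : EuclideanSpace ℝ (Fin k)) x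
  Bᵀ * Matrix.diagonal (fun x => (Pstar x)⁻¹) * B

end InfoGeom

/-!
Expand the estimating equation at `θ₀`.  The remainder, averaged over the sample, is at most the
average of the modulus of continuity of `∂s` times `‖θ̂ - θ₀‖`; by dominated convergence the modulus
has small expectation on small neighbourhoods, so the law of large numbers makes the remainder
`o_P(θ̂ - θ₀)` along any consistent root.  The residual `Y - μ(Z, θ₀)` is conditionally centred, so
the derivative of the weights `Dᵀ W` drops out of `E[∂s] = -J`, and `E[s sᵀ] = K`.  Since `J` is
invertible, the remainder is absorbed into the left-hand side, giving
`θ̂ - θ₀ = J⁻¹ n⁻¹ ∑ s(Xᵢ, θ₀)` up to a relative error `o_P(1)`.  The central limit theorem and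
Slutsky's lemma give the normal limit; the rate follows from tightness because `√(log n) → ∞`, and
`a H ⪯ J` transfers it to `H` because it implies `a λ_min(H) ≤ λ_min(J)`.
-/

section SmallestEigenvalue

variable {p : ℕ} {M N : Matrix (Fin p) (Fin p) ℝ}

theorem posSemidef_sub_smul_one_iff (hM : M.IsHermitian) (c : ℝ) :
    (M - c • (1 : Matrix (Fin p) (Fin p) ℝ)).PosSemidef ↔ ∀ e ∈ spectrum ℝ M, c ≤ e := by
  have hHerm : (M - c • (1 : Matrix (Fin p) (Fin p) ℝ)).IsHermitian :=
    hM.sub (Matrix.isHermitian_one.smul (.all c))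
  rw [Matrix.posSemidef_iff_isHermitian_and_spectrum_nonneg, and_iff_right hHerm,
    ← Algebra.algebraMap_eq_smul_one, ← spectrum.sub_singleton_eq, Set.sub_singleton]
  simp [Set.subset_def]

theorem posSemidef_sub_lambdaMin (hM : M.IsHermitian) :
    (M - lambdaMin M • (1 : Matrix (Fin p) (Fin p) ℝ)).PosSemidef :=
  (posSemidef_sub_smul_one_iff hM _).2 fun _ he => csInf_le (Matrix.finite_spectrum M).bddBelow he

theorem spectrum_nonempty_of_isHermitian (hp : 0 < p) (hM : M.IsHermitian) :
    (spectrum ℝ M).Nonempty := by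
  rw [hM.spectrum_real_eq_range_eigenvalues]
  exact ⟨_, ⟨0, hp⟩, rfl⟩

theorem le_lambdaMin (hp : 0 < p) (hM : M.IsHermitian) {c : ℝ}
    (h : (M - c • (1 : Matrix (Fin p) (Fin p) ℝ)).PosSemidef) : c ≤ lambdaMin M :=
  le_csInf (spectrum_nonempty_of_isHermitian hp hM) ((posSemidef_sub_smul_one_iff hM c).1 h)

theorem pos_of_lambdaMin_pos (h : 0 < lambdaMin M) : 0 < p := by
  rcases Nat.eq_zero_or_pos p with rfl | hp
  · simp [lambdaMin, spectrum.of_subsingleton] at h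
  · exact hp

theorem posDef_of_lambdaMin_pos (hM : M.IsHermitian) (h : 0 < lambdaMin M) : M.PosDef := by
  have hscalar : (lambdaMin M • (1 : Matrix (Fin p) (Fin p) ℝ)).PosDef := Matrix.PosDef.one.smul h
  simpa using hscalar.posSemidef_add (posSemidef_sub_lambdaMin hM)

theorem lambdaMin_pos (hp : 0 < p) (hM : M.PosDef) : 0 < lambdaMin M := by
  refine ((Matrix.finite_spectrum M).lt_csInf_iff
    (spectrum_nonempty_of_isHermitian hp hM.isHermitian)).2 ?_
  rw [hM.isHermitian.spectrum_real_eq_range_eigenvalues]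
  rintro _ ⟨i, rfl⟩
  exact hM.eigenvalues_pos i

theorem mul_lambdaMin_le_of_posSemidef_sub (hp : 0 < p) (hM : M.IsHermitian) (hN : N.IsHermitian)
    {a : ℝ} (ha : 0 ≤ a) (h : (M - a • N).PosSemidef) : a * lambdaMin N ≤ lambdaMin M := by
  refine le_lambdaMin hp hM ?_
  have hsum := h.add ((posSemidef_sub_lambdaMin hN).smul ha)
  rwa [smul_sub, smul_smul, sub_add_sub_cancel] at hsum

end SmallestEigenvalue

theorem InfoGeom.hessian_posDef {p k d : ℕ} {h : Fin k → EuclideanSpace ℝ (Fin d)}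
    (V : OrthonormalBasis (Fin p) ℝ (InfoGeom.tangent h)) {Q : Fin k → ℝ} (hQ : ∀ x, 0 < Q x) :
    (InfoGeom.hessian V Q).PosDef := by
  refine (Matrix.PosDef.diagonal fun x => inv_pos.2 (hQ x)).conjTranspose_mul_mul_same ?_
  intro v w hvw
  have hcomb : ∑ a, v a • V a = ∑ a, w a • V a := by
    ext x
    simpa [Matrix.mulVec, dotProduct, mul_comm] using congrFun hvw x
  have hindep := V.toBasis.linearIndependent
  rw [linearIndependent_iff_injective_fintypeLinearCombination] at hindep
  exact hindep (by simpa [Fintype.linearCombination_apply] using hcomb)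

section LittleOInProb

variable {Ω E F : Type*} [MeasurableSpace Ω] {P : Measure Ω}
  [NormedAddCommGroup E] [NormedAddCommGroup F]

theorem tendsto_measure_zero_of_subset_union {A B C : ℕ → Set Ω}
    (hA : Tendsto (fun n => P (A n)) atTop (𝓝 0)) (hB : Tendsto (fun n => P (B n)) atTop (𝓝 0))
    (h : ∀ n, C n ⊆ A n ∪ B n) : Tendsto (fun n => P (C n)) atTop (𝓝 0) := by
  have hsum := hA.add hB
  rw [add_zero] at hsum
  exact tendsto_of_tendsto_of_tendsto_of_le_of_le tendsto_const_nhds hsum (fun _ => zero_le)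
    fun n => (measure_mono (h n)).trans (measure_union_le _ _)

theorem tendsto_measure_zero_of_subset {A C : ℕ → Set Ω}
    (hA : Tendsto (fun n => P (A n)) atTop (𝓝 0)) (h : ∀ n, C n ⊆ A n) :
    Tendsto (fun n => P (C n)) atTop (𝓝 0) :=
  tendsto_measure_zero_of_subset_union hA hA fun n => (h n).trans Set.subset_union_left

/-- `Y = o_P(T)`: for every `κ > 0`, the probability that `‖Y n‖ > κ * ‖T n‖` tends to `0`.  The
comparison sequence `T` is random and may vanish, so this is stated without quotients. -/
def IsLittleOInProb (P : Measure Ω) (Y : ℕ → Ω → E) (T : ℕ → Ω → F) : Prop :=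
  ∀ κ : ℝ, 0 < κ → Tendsto (fun n => P {ω | κ * ‖T n ω‖ < ‖Y n ω‖}) atTop (𝓝 0)

namespace IsLittleOInProb

variable {Y Y' : ℕ → Ω → E} {T : ℕ → Ω → F}

theorem of_tendsto_measure_norm_gt {E' : Type*} [NormedAddCommGroup E'] {Z : ℕ → Ω → E'}
    (hY : IsLittleOInProb P Y T) {c : ℝ} (hc : 0 < c)
    (h : Tendsto (fun n => P {ω | c * ‖Y n ω‖ < ‖Z n ω‖}) atTop (𝓝 0)) :
    IsLittleOInProb P Z T := by
  intro κ hκ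
  refine tendsto_measure_zero_of_subset_union (hY (κ / c) (by positivity)) h fun n ω hω => ?_
  by_contra hnot
  simp only [Set.mem_union, Set.mem_ofPred_eq, not_or, not_lt] at hω hnot
  have hmul := mul_le_mul_of_nonneg_left hnot.1 hc.le
  rw [← mul_assoc, mul_div_cancel₀ κ hc.ne'] at hmul
  linarith [hnot.2]

theorem add (hY : IsLittleOInProb P Y T) (hY' : IsLittleOInProb P Y' T) :
    IsLittleOInProb P (fun n ω => Y n ω + Y' n ω) T := by
  intro κ hκ
  refine tendsto_measure_zero_of_subset_union (hY (κ / 2) (by positivity))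
    (hY' (κ / 2) (by positivity)) fun n ω hω => ?_
  by_contra hnot
  simp only [Set.mem_union, Set.mem_ofPred_eq, not_or, not_lt] at hω hnot
  linarith [hnot.1, hnot.2, norm_add_le (Y n ω) (Y' n ω)]

theorem sub_right_of_sub_left (h : IsLittleOInProb P (fun n ω => Y n ω - Y' n ω) Y) :
    IsLittleOInProb P (fun n ω => Y n ω - Y' n ω) Y' := by
  intro κ hκ
  refine tendsto_measure_zero_of_subset (h (min (1 / 2) (κ / 2)) (by positivity)) fun n ω hω => ?_
  by_contra hnot
  simp only [Set.mem_ofPred_eq, not_lt] at hω hnot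
  have htri : ‖Y n ω‖ ≤ ‖Y n ω - Y' n ω‖ + ‖Y' n ω‖ := by
    simpa using norm_add_le (Y n ω - Y' n ω) (Y' n ω)
  have hhalf := mul_le_mul_of_nonneg_right (min_le_left (1 / 2) (κ / 2)) (norm_nonneg (Y n ω))
  have hκhalf : min (1 / 2) (κ / 2) * ‖Y n ω‖ ≤ κ / 2 * (2 * ‖Y' n ω‖) :=
    mul_le_mul (min_le_right _ _) (by linarith) (norm_nonneg _) (by positivity)
  linarith

theorem smul [NormedSpace ℝ E] [NormedSpace ℝ F] (h : IsLittleOInProb P Y T) (a : ℕ → ℝ) :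
    IsLittleOInProb P (fun n ω => a n • Y n ω) (fun n ω => a n • T n ω) := by
  intro κ hκ
  refine tendsto_measure_zero_of_subset (h κ hκ) fun n ω hω => ?_
  simp only [Set.mem_ofPred_eq, norm_smul, mul_left_comm κ] at hω
  exact lt_of_mul_lt_mul_left hω (norm_nonneg _)

theorem tendstoInMeasure_zero {C : ℝ → ℝ} (h : IsLittleOInProb P Y T)
    (hT : IsBigOInProbWith C P T fun _ => 1) : TendstoInMeasure P Y atTop 0 := by
  refine tendstoInMeasure_iff_norm.2 fun ε hε => ENNReal.tendsto_nhds_zero.2 fun δ hδ => ?_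
  obtain ⟨η, hη, hηδ⟩ : ∃ η : ℝ, 0 < η ∧ ENNReal.ofReal η ≤ δ / 2 := by
    obtain ⟨η, hη, hηδ⟩ := ENNReal.lt_iff_exists_nnreal_btwn.1 (ENNReal.half_pos hδ.ne')
    exact ⟨η, by exact_mod_cast hη, by simpa using hηδ.le⟩
  have hκ : 0 < ε / (2 * (|C η| + 1)) := by positivity
  filter_upwards [hT η hη, ENNReal.tendsto_nhds_zero.1 (h _ hκ) (δ / 2) (ENNReal.half_pos hδ.ne')]
    with n hTn hYn
  refine (measure_mono fun ω hω => ?_).trans ((measure_union_le _ _).trans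
    ((add_le_add (hTn.trans hηδ) hYn).trans_eq (ENNReal.add_halves δ)))
  by_contra hnot
  simp only [Set.mem_union, Set.mem_ofPred_eq, not_or, not_lt, Pi.zero_apply, sub_zero,
    mul_one] at hω hnot
  have hTle : ‖T n ω‖ ≤ |C η| + 1 := by linarith [le_abs_self (C η), hnot.1]
  have hYle : ‖Y n ω‖ ≤ ε / 2 := calc
    ‖Y n ω‖ ≤ ε / (2 * (|C η| + 1)) * (|C η| + 1) :=
      hnot.2.trans (mul_le_mul_of_nonneg_left hTle hκ.le)
    _ = ε / 2 := by field_simp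
  linarith

end IsLittleOInProb

theorem isLittleOInProb_sub_apply [NormedSpace ℝ E] [NormedSpace ℝ F] {A : ℕ → Ω → E →L[ℝ] F}
    {A₀ : E →L[ℝ] F} (hA : TendstoInMeasure P A atTop fun _ => A₀) (X : ℕ → Ω → E) :
    IsLittleOInProb P (fun n ω => (A n ω - A₀) (X n ω)) X := by
  intro κ hκ
  refine tendsto_measure_zero_of_subset (tendstoInMeasure_iff_norm.1 hA κ hκ) fun n ω hω => ?_
  simp only [Set.mem_ofPred_eq] at hω ⊢
  exact (lt_of_mul_lt_mul_right (hω.trans_le ((A n ω - A₀).le_opNorm _)) (norm_nonneg _)).le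

end LittleOInProb

section EmpiricalMean

variable {Ω 𝓧 E F : Type*} {X : ℕ → Ω → 𝓧}
  [NormedAddCommGroup E] [NormedSpace ℝ E] [NormedAddCommGroup F] [NormedSpace ℝ F]

/-- The average of `f` over the observations `X 0, …, X (n - 1)`; it is `0` for `n = 0`. -/
noncomputable def empiricalMean (X : ℕ → Ω → 𝓧) (f : 𝓧 → E) (n : ℕ) (ω : Ω) : E :=
  (n : ℝ)⁻¹ • ∑ i ∈ Finset.range n, f (X i ω)

theorem empiricalMean_sub (f g : 𝓧 → E) (n : ℕ) (ω : Ω) :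
    empiricalMean X (fun x => f x - g x) n ω = empiricalMean X f n ω - empiricalMean X g n ω := by
  simp [empiricalMean, smul_sub]

theorem map_empiricalMean (L : E →L[ℝ] F) (f : 𝓧 → E) (n : ℕ) (ω : Ω) :
    empiricalMean X (fun x => L (f x)) n ω = L (empiricalMean X f n ω) := by
  simp [empiricalMean]

theorem norm_empiricalMean_le {f : 𝓧 → E} {g : 𝓧 → ℝ} {c : ℝ} (h : ∀ x, ‖f x‖ ≤ g x * c)
    (n : ℕ) (ω : Ω) : ‖empiricalMean X f n ω‖ ≤ empiricalMean X g n ω * c := by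
  simp only [empiricalMean, norm_smul, smul_eq_mul, mul_assoc, Finset.sum_mul,
    Real.norm_of_nonneg (inv_nonneg.2 n.cast_nonneg)]
  gcongr
  exact norm_sum_le_of_le _ fun i _ => h _

theorem sub_empiricalMean_influence_eq {s : 𝓧 → E → F} {L : F →L[ℝ] E}
    {A : E →L[ℝ] F} (hL : L ∘L A = -ContinuousLinearMap.id ℝ E) (D : 𝓧 → E →L[ℝ] F) {θ θ₀ : E}
    {n : ℕ} {ω : Ω} (hroot : ∑ i ∈ Finset.range n, s (X i ω) θ = 0) :
    (θ - θ₀) - empiricalMean X (fun x => L (s x θ₀)) n ω =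
      L (empiricalMean X (fun x => s x θ - s x θ₀ - D x (θ - θ₀)) n ω +
        (empiricalMean X D n ω - A) (θ - θ₀)) := by
  have hmean_root : empiricalMean X (fun x => s x θ) n ω = 0 := by simp [empiricalMean, hroot]
  have hLA : L (A (θ - θ₀)) = -(θ - θ₀) := DFunLike.congr_fun hL (θ - θ₀)
  have heval : empiricalMean X (fun x => D x (θ - θ₀)) n ω = empiricalMean X D n ω (θ - θ₀) :=
    map_empiricalMean (ContinuousLinearMap.apply ℝ F (θ - θ₀)) D n ω
  rw [empiricalMean_sub, empiricalMean_sub, hmean_root, heval, map_empiricalMean, sub_apply]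
  simp only [map_add, map_sub, map_zero] at hLA ⊢
  rw [hLA]
  abel

variable [MeasurableSpace Ω] {P : Measure Ω} [MeasurableSpace 𝓧] {ρ : Measure 𝓧}

theorem tendstoInMeasure_empiricalMean [CompleteSpace E] [IsFiniteMeasure P]
    (hlaw : ∀ i, HasLaw (X i) ρ P) (hindep : Pairwise (Function.onFun (· ⟂ᵢ[P] ·) X)) {f : 𝓧 → E}
    (hf : Integrable f ρ) :
    TendstoInMeasure P (empiricalMean X f) atTop fun _ => ∫ x, f x ∂ρ := by
  borelize E
  have hfX (i : ℕ) : Integrable (fun ω => f (X i ω)) P :=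
    Integrable.comp_aemeasurable (by rwa [(hlaw i).map_eq]) (hlaw i).aemeasurable
  have hfm (i : ℕ) : AEMeasurable f (P.map (X i)) :=
    (hlaw i).map_eq ▸ hf.aestronglyMeasurable.aemeasurable
  have hlim := strong_law_ae (fun i ω => f (X i ω)) (hfX 0)
    (fun i j hij => (hindep hij).comp₀ (hlaw i).aemeasurable (hlaw j).aemeasurable (hfm i) (hfm j))
    fun i => ((hlaw i).identDistrib (hlaw 0)).comp_of_aemeasurable (hfm i)
  rw [show ∫ ω, f (X 0 ω) ∂P = ∫ x, f x ∂ρ from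
    (hlaw 0).integral_comp hf.aestronglyMeasurable] at hlim
  exact tendstoInMeasure_of_tendsto_ae
    (fun n => (integrable_finsetSum _ fun i _ => hfX i).aestronglyMeasurable.const_smul _) hlim

end EmpiricalMean

section CentralLimitTheorem

variable {Ω 𝓧 ι : Type*} [MeasurableSpace Ω] {P : Measure Ω} [MeasurableSpace 𝓧] {ρ : Measure 𝓧}
  {X : ℕ → Ω → 𝓧} [Fintype ι] [DecidableEq ι]

theorem charFun_map_eq_charFun_map_inner {E : Type*} [NormedAddCommGroup E] [InnerProductSpace ℝ E]
    [MeasurableSpace E] [BorelSpace E] [SecondCountableTopology E] {Y : Ω → E}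
    (hY : AEMeasurable Y P) (t : E) :
    charFun (P.map Y) t = charFun (P.map fun ω => inner ℝ (Y ω) t) 1 := by
  rw [charFun_apply, charFun_apply, integral_map hY (by fun_prop),
    integral_map (by fun_prop) (by fun_prop)]
  simp

theorem tendsto_charFun_sqrt_mul_empiricalMean [IsProbabilityMeasure P]
    (hlaw : ∀ i, HasLaw (X i) ρ P) (hindep : iIndepFun X P) {f : 𝓧 → ℝ} (hf : MemLp f 2 ρ)
    (hmean : ∫ x, f x ∂ρ = 0) :
    Tendsto (fun n : ℕ => charFun (P.map fun ω => √(n : ℝ) * empiricalMean X f n ω) 1)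
      atTop (𝓝 (Complex.exp (-((∫ x, f x ^ 2 ∂ρ : ℝ) : ℂ) / 2))) := by
  have hfm (i : ℕ) : AEMeasurable f (P.map (X i)) := by
    rw [(hlaw i).map_eq]; exact hf.aemeasurable
  have hfX : MemLp (fun ω => f (X 0 ω)) 2 P :=
    MemLp.comp_of_map (by rwa [(hlaw 0).map_eq]) (hlaw 0).aemeasurable
  have hmeanX : ∫ ω, f (X 0 ω) ∂P = 0 :=
    ((hlaw 0).integral_comp hf.aestronglyMeasurable).trans hmean
  have hvar : Var[f ∘ X 0; P] = ∫ x, f x ^ 2 ∂ρ := by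
    rw [Function.comp_def, variance_of_integral_eq_zero hfX.aemeasurable hmeanX]
    exact (hlaw 0).integral_comp (f := fun x => f x ^ 2) (hf.aestronglyMeasurable.pow 2)
  have hclt := ProbabilityMeasure.tendsto_iff_tendsto_charFun.1
    (tendstoInDistribution_inv_sqrt_mul_sum_sub HasLaw.id hfX
      (hindep.comp₀ (fun _ => f) (fun i => (hlaw i).aemeasurable) hfm)
      fun i => ((hlaw i).identDistrib (hlaw 0)).comp_of_aemeasurable (hfm i)).tendsto 1
  have hvar_nonneg : 0 ≤ ∫ x, f x ^ 2 ∂ρ := integral_nonneg fun x => sq_nonneg _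
  simpa [hmeanX, charFun_gaussianReal, hvar, neg_div, max_eq_left hvar_nonneg, empiricalMean,
    ← mul_assoc, ← div_eq_mul_inv, Real.sqrt_div_self] using hclt

theorem tendstoInDistribution_sqrt_smul_empiricalMean [IsProbabilityMeasure P]
    (hlaw : ∀ i, HasLaw (X i) ρ P) (hindep : iIndepFun X P) {f : 𝓧 → EuclideanSpace ℝ ι}
    (hf : MemLp f 2 ρ) (hmean : ∫ x, f x ∂ρ = 0) {S : Matrix ι ι ℝ} (hS : S.PosSemidef)
    (hcov : ∀ t : EuclideanSpace ℝ ι, ∫ x, inner ℝ (f x) t ^ 2 ∂ρ = t ⬝ᵥ S *ᵥ t) :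
    TendstoInDistribution (fun (n : ℕ) ω => √(n : ℝ) • empiricalMean X f n ω) atTop id
      (fun _ => P) (multivariateGaussian 0 S) := by
  have : IsProbabilityMeasure ρ := (hlaw 0).isProbabilityMeasure_iff.1 ‹_›
  have hfX (i : ℕ) : AEMeasurable (fun ω => f (X i ω)) P :=
    ((hlaw i).map_eq ▸ hf.aemeasurable).comp_aemeasurable (hlaw i).aemeasurable
  have hmean_meas (n : ℕ) : AEMeasurable (fun ω => √(n : ℝ) • empiricalMean X f n ω) P :=
    ((Finset.aemeasurable_fun_sum (Finset.range n) fun i _ => hfX i).const_smul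
      (n : ℝ)⁻¹).const_smul √(n : ℝ)
  refine ⟨hmean_meas, aemeasurable_id, ProbabilityMeasure.tendsto_iff_tendsto_charFun.2 fun t => ?_⟩
  have hmean_inner : ∫ x, inner ℝ (f x) t ∂ρ = 0 := by
    simp_rw [real_inner_comm t]
    rw [integral_inner (hf.integrable one_le_two), hmean, inner_zero_right]
  have hclt := tendsto_charFun_sqrt_mul_empiricalMean hlaw hindep (hf.inner_const t) hmean_inner
  rw [hcov] at hclt
  simp only [ProbabilityMeasure.coe_mk, Measure.map_id, charFun_multivariateGaussian hS]
  refine (hclt.congr fun n => ?_).trans (by simp [neg_div])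
  rw [charFun_map_eq_charFun_map_inner (hmean_meas n)]
  simp [empiricalMean, inner_smul_left, sum_inner]

theorem exists_isBigOInProbWith_one_of_tendstoInDistribution [IsProbabilityMeasure P]
    {E Ω' : Type*} [MeasurableSpace Ω'] {P' : Measure Ω'} [IsProbabilityMeasure P']
    [NormedAddCommGroup E] [InnerProductSpace ℝ E] [FiniteDimensional ℝ E] [MeasurableSpace E]
    [BorelSpace E] {T : ℕ → Ω → E} {Z : Ω' → E}
    (h : TendstoInDistribution T atTop Z (fun _ => P) P') :
    ∃ C : ℝ → ℝ, IsBigOInProbWith C P T fun _ => 1 := by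
  have hprob (n : ℕ) : IsProbabilityMeasure (P.map (T n)) :=
    Measure.isProbabilityMeasure_map (h.forall_aemeasurable n)
  have : IsProbabilityMeasure (P'.map Z) :=
    Measure.isProbabilityMeasure_map h.aemeasurable_limit
  have htight : IsTightMeasureSet (Set.range fun n => P.map (T n)) :=
    isTightMeasureSet_of_tendsto_charFun (f := charFun (P'.map Z)) (by fun_prop)
      (ProbabilityMeasure.tendsto_iff_tendsto_charFun.1 h.tendsto)
  have hradius (ε : ℝ) : ∃ r : ℝ, 0 < ε → ∀ n, P {ω | r < ‖T n ω‖} ≤ ENNReal.ofReal ε := by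
    by_cases hε : 0 < ε
    · obtain ⟨r, hr⟩ := (ENNReal.tendsto_nhds_zero.1
        (tendsto_measure_norm_gt_of_isTightMeasureSet htight) _ (ENNReal.ofReal_pos.2 hε)).exists
      refine ⟨r, fun _ n => le_trans ?_ hr⟩
      rw [iSup_range]
      refine le_trans ?_ (le_iSup _ n)
      rw [Measure.map_apply_of_aemeasurable (h.forall_aemeasurable n)
        (measurableSet_lt measurable_const measurable_norm)]
      rfl
    · exact ⟨0, fun h => absurd h hε⟩
  choose C hC using hradius
  exact ⟨C, fun ε hε => .of_forall fun n => by simpa using hC ε hε n⟩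

end CentralLimitTheorem

section MeasurableDerivative

variable {𝓧 E F : Type*} [MeasurableSpace 𝓧] [NormedAddCommGroup E] [NormedSpace ℝ E]
  [NormedAddCommGroup F] [NormedSpace ℝ F] [MeasurableSpace F] [BorelSpace F]
  [SecondCountableTopology F] {f : 𝓧 → E → F} {θ : E}

theorem measurable_fderiv_apply_param (hm : ∀ᶠ θ' in 𝓝 θ, Measurable fun x => f x θ')
    (hd : ∀ x, DifferentiableAt ℝ (f x) θ) (v : E) : Measurable fun x => fderiv ℝ (f x) θ v := by
  have hlim : Tendsto (fun n : ℕ => θ + (n : ℝ)⁻¹ • v) atTop (𝓝 θ) := by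
    simpa using ((tendsto_inv_atTop_nhds_zero_nat (𝕜 := ℝ)).smul_const v).const_add θ
  obtain ⟨N, hN⟩ := eventually_atTop.1 (hlim.eventually hm)
  refine measurable_of_tendsto_metrizable
    (f := fun (n : ℕ) x => ((n + N : ℕ) : ℝ) • (f x (θ + ((n + N : ℕ) : ℝ)⁻¹ • v) - f x θ))
    (fun n => ((hN _ (Nat.le_add_left _ _)).sub hm.self_of_nhds).const_smul _)
    (tendsto_pi_nhds.2 fun x => ?_)
  exact ((hd x).hasFDerivAt.lim_real v).comp
    (tendsto_natCast_atTop_atTop.comp (tendsto_add_atTop_nat N))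

theorem stronglyMeasurable_fderiv_param [FiniteDimensional ℝ E]
    (hm : ∀ᶠ θ' in 𝓝 θ, Measurable fun x => f x θ') (hd : ∀ x, DifferentiableAt ℝ (f x) θ) :
    StronglyMeasurable fun x => fderiv ℝ (f x) θ := by
  let b := Module.finBasis ℝ E
  have hsum (x : 𝓧) : fderiv ℝ (f x) θ = ∑ i, ContinuousLinearMap.smulRightL ℝ E F
      (b.coord i).toContinuousLinearMap (fderiv ℝ (f x) θ (b i)) := by
    refine ContinuousLinearMap.coe_injective (b.ext fun j => ?_)
    simp [Finsupp.single_apply]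
  rw [funext hsum]
  exact Finset.stronglyMeasurable_fun_sum _ fun i _ =>
    (ContinuousLinearMap.continuous _).comp_stronglyMeasurable
      (measurable_fderiv_apply_param hm hd _).stronglyMeasurable

end MeasurableDerivative

section UniformLinearization

variable {𝓧 E F : Type*} [NormedAddCommGroup E] [NormedAddCommGroup F]

/-- The modulus of continuity at `θ₀`: the supremum of `‖g θ - g θ₀‖` over `‖θ - θ₀‖ < δ`.  It takes
values in `[0, ∞]`, so that no boundedness is presupposed. -/
noncomputable def modulusAt (g : E → F) (θ₀ : E) (δ : ℝ) : ENNReal :=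
  ⨆ θ : Metric.ball θ₀ δ, ‖g θ - g θ₀‖ₑ

theorem enorm_sub_le_modulusAt {g : E → F} {θ θ₀ : E} {δ : ℝ} (hθ : θ ∈ Metric.ball θ₀ δ) :
    ‖g θ - g θ₀‖ₑ ≤ modulusAt g θ₀ δ :=
  le_iSup (fun θ : Metric.ball θ₀ δ => ‖g θ - g θ₀‖ₑ) ⟨θ, hθ⟩

theorem tendsto_modulusAt {g : E → F} {θ₀ : E} (hg : ContinuousAt g θ₀) :
    Tendsto (modulusAt g θ₀) (𝓝[>] 0) (𝓝 0) := by
  refine ENNReal.tendsto_nhds_zero.2 fun ε hε => ?_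
  have hclose : ∀ᶠ θ in 𝓝 θ₀, ‖g θ - g θ₀‖ₑ ≤ ε := by
    have hsub : Tendsto (fun θ => ‖g θ - g θ₀‖ₑ) (𝓝 θ₀) (𝓝 0) := by
      simpa using (hg.sub (continuousAt_const (y := g θ₀))).enorm.tendsto
    exact ENNReal.tendsto_nhds_zero.1 hsub ε hε
  obtain ⟨r, hr, hball⟩ := Metric.eventually_nhds_iff_ball.1 hclose
  filter_upwards [Ioo_mem_nhdsGT hr] with δ hδ
  exact iSup_le fun θ => hball θ (Metric.ball_subset_ball hδ.2.le θ.2)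

variable [MeasurableSpace 𝓧] [SecondCountableTopology E]

theorem measurable_modulusAt {g : 𝓧 → E → F} {θ₀ : E} {δ : ℝ} (hδ : 0 < δ)
    (hc : ∀ x, ContinuousOn (g x) (Metric.ball θ₀ δ))
    (hm : ∀ θ ∈ Metric.ball θ₀ δ, StronglyMeasurable fun x => g x θ) :
    Measurable fun x => modulusAt (g x) θ₀ δ := by
  obtain ⟨S, hS, hSd⟩ := TopologicalSpace.exists_countable_dense (Metric.ball θ₀ δ)
  have hsup (x : 𝓧) : modulusAt (g x) θ₀ δ = ⨆ θ : S, ‖g x θ.1 - g x θ₀‖ₑ :=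
    (hSd.ciSup' ((hc x).domRestrict.sub continuous_const).enorm).symm
  have := hS.to_subtype
  simp_rw [hsup]
  exact .iSup fun θ => ((hm _ θ.1.2).sub (hm _ (Metric.mem_ball_self hδ))).enorm

theorem exists_integrable_modulus_bound {ρ : Measure 𝓧} {g : 𝓧 → E → F} {θ₀ : E}
    (hc : ∀ᶠ θ in 𝓝 θ₀, ∀ x, ContinuousAt (g x) θ)
    (hm : ∀ᶠ θ in 𝓝 θ₀, StronglyMeasurable fun x => g x θ) {G : 𝓧 → ℝ} (hG : Integrable G ρ)
    (hle : ∀ᶠ θ in 𝓝 θ₀, ∀ x, ‖g x θ‖ ≤ G x) {ε : ℝ} (hε : 0 < ε) :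
    ∃ R : 𝓧 → ℝ, Integrable R ρ ∧ ∫ x, R x ∂ρ < ε ∧
      ∀ᶠ θ in 𝓝 θ₀, ∀ x, ‖g x θ - g x θ₀‖ ≤ R x := by
  obtain ⟨r, hr, hball⟩ := Metric.eventually_nhds_iff_ball.1 (hc.and (hm.and hle))
  have hsmall : ∀ᶠ δ in 𝓝[>] (0 : ℝ), δ ∈ Set.Ioo 0 r := Ioo_mem_nhdsGT hr
  have hmeas : ∀ᶠ δ in 𝓝[>] 0, Measurable fun x => modulusAt (g x) θ₀ δ := by
    filter_upwards [hsmall] with δ hδ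
    have hsub := Metric.ball_subset_ball (x := θ₀) hδ.2.le
    exact measurable_modulusAt hδ.1
      (fun x θ hθ => ((hball θ (hsub hθ)).1 x).continuousWithinAt)
      fun θ hθ => (hball θ (hsub hθ)).2.1
  have hdom : ∀ᶠ δ in 𝓝[>] 0, ∀ x, modulusAt (g x) θ₀ δ ≤ ENNReal.ofReal (2 * G x) := by
    filter_upwards [hsmall] with δ hδ x
    refine iSup_le fun θ => ?_
    have hθ := (hball θ (Metric.ball_subset_ball hδ.2.le θ.2)).2.2 x
    have hθ₀ := (hball θ₀ (Metric.mem_ball_self hr)).2.2 x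
    rw [← ofReal_norm]
    exact ENNReal.ofReal_le_ofReal (by linarith [norm_sub_le (g x θ) (g x θ₀)])
  have hlim : Tendsto (fun δ => ∫⁻ x, modulusAt (g x) θ₀ δ ∂ρ) (𝓝[>] 0) (𝓝 0) := by
    simpa using tendsto_lintegral_filter_of_dominated_convergence _ hmeas
      (hdom.mono fun δ hδ => ae_of_all ρ hδ) (hG.const_mul 2).lintegral_lt_top.ne
      (ae_of_all ρ fun x => tendsto_modulusAt (hc.self_of_nhds x))
  obtain ⟨δ, hδ, hδm, hδG, hδε⟩ := (hsmall.and (hmeas.and (hdom.and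
    (hlim.eventually_lt_const (ENNReal.ofReal_pos.2 hε))))).exists
  have hfin (x : 𝓧) : modulusAt (g x) θ₀ δ ≠ ⊤ := ((hδG x).trans_lt ENNReal.ofReal_lt_top).ne
  refine ⟨fun x => (modulusAt (g x) θ₀ δ).toReal, integrable_toReal_of_lintegral_ne_top
    hδm.aemeasurable (hδε.trans ENNReal.ofReal_lt_top).ne, ?_, ?_⟩
  · rw [integral_toReal hδm.aemeasurable (ae_of_all _ fun x => (hfin x).lt_top)]
    exact (ENNReal.lt_ofReal_iff_toReal_lt (hδε.trans ENNReal.ofReal_lt_top).ne).1 hδε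
  · filter_upwards [Metric.ball_mem_nhds θ₀ hδ.1] with θ hθ x
    rw [← toReal_enorm]
    exact ENNReal.toReal_mono (hfin x) (enorm_sub_le_modulusAt hθ)

theorem exists_integrable_linearization_bound [NormedSpace ℝ E] [FiniteDimensional ℝ E]
    [NormedSpace ℝ F] [MeasurableSpace F] [BorelSpace F] [SecondCountableTopology F]
    {ρ : Measure 𝓧} {s : 𝓧 → E → F} {θ₀ : E} (hs : ∀ᶠ θ in 𝓝 θ₀, ∀ x, ContDiffAt ℝ 1 (s x) θ)
    (hm : ∀ᶠ θ in 𝓝 θ₀, Measurable fun x => s x θ) {G : 𝓧 → ℝ} (hG : Integrable G ρ)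
    (hle : ∀ᶠ θ in 𝓝 θ₀, ∀ x, ‖fderiv ℝ (s x) θ‖ ≤ G x) {ε : ℝ} (hε : 0 < ε) :
    ∃ R : 𝓧 → ℝ, Integrable R ρ ∧ ∫ x, R x ∂ρ < ε ∧ ∀ᶠ θ in 𝓝 θ₀, ∀ x,
      ‖s x θ - s x θ₀ - fderiv ℝ (s x) θ₀ (θ - θ₀)‖ ≤ R x * ‖θ - θ₀‖ := by
  have hd : ∀ᶠ θ in 𝓝 θ₀, ∀ x, DifferentiableAt ℝ (s x) θ :=
    hs.mono fun θ hθ x => (hθ x).differentiableAt one_ne_zero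
  obtain ⟨R, hR, hRε, hbound⟩ := exists_integrable_modulus_bound
    (hs.mono fun θ hθ x => (hθ x).continuousAt_fderiv one_ne_zero)
    ((hm.eventually_nhds.and hd).mono fun θ hθ => stronglyMeasurable_fderiv_param hθ.1 hθ.2)
    hG hle hε
  refine ⟨R, hR, hRε, ?_⟩
  obtain ⟨r, hr, hball⟩ := Metric.eventually_nhds_iff_ball.1 (hd.and hbound)
  filter_upwards [Metric.ball_mem_nhds θ₀ hr] with θ hθ x
  exact (convex_ball θ₀ r).norm_image_sub_le_of_norm_fderiv_le' (fun θ' hθ' => (hball θ' hθ').1 x)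
    (fun θ' hθ' => (hball θ' hθ').2 x) (Metric.mem_ball_self hr) hθ

end UniformLinearization

section ZEstimator

variable {Ω 𝓧 E F : Type*} [MeasurableSpace Ω] {P : Measure Ω} [NormedAddCommGroup E]
  [NormedAddCommGroup F] {X : ℕ → Ω → 𝓧} {θhat : ℕ → Ω → E} {θ₀ : E}

theorem tendsto_measure_not_of_tendstoInMeasure (hcons : TendstoInMeasure P θhat atTop fun _ => θ₀)
    {p : E → Prop} (hp : ∀ᶠ θ in 𝓝 θ₀, p θ) :
    Tendsto (fun n => P {ω | ¬ p (θhat n ω)}) atTop (𝓝 0) := by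
  obtain ⟨r, hr, hball⟩ := Metric.eventually_nhds_iff_ball.1 hp
  refine tendsto_measure_zero_of_subset (tendstoInMeasure_iff_dist.1 hcons r hr) fun n ω hω => ?_
  by_contra hnot
  exact hω (hball _ (by simpa using hnot))

variable [MeasurableSpace 𝓧] {ρ : Measure 𝓧} [IsFiniteMeasure P] [NormedSpace ℝ F]

theorem isLittleOInProb_empiricalMean (hlaw : ∀ i, HasLaw (X i) ρ P)
    (hindep : Pairwise (Function.onFun (· ⟂ᵢ[P] ·) X))
    (hcons : TendstoInMeasure P θhat atTop fun _ => θ₀) {r : 𝓧 → E → F}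
    (hr : ∀ ε > 0, ∃ R : 𝓧 → ℝ, Integrable R ρ ∧ ∫ x, R x ∂ρ < ε ∧
      ∀ᶠ θ in 𝓝 θ₀, ∀ x, ‖r x θ‖ ≤ R x * ‖θ - θ₀‖) :
    IsLittleOInProb P (fun n ω => empiricalMean X (fun x => r x (θhat n ω)) n ω)
      fun n ω => θhat n ω - θ₀ := by
  intro κ hκ
  obtain ⟨R, hR, hRκ, hbound⟩ := hr κ hκ
  have hfar : Tendsto (fun n => P {ω | ¬ ∀ x, ‖r x (θhat n ω)‖ ≤ R x * ‖θhat n ω - θ₀‖})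
      atTop (𝓝 0) :=
    tendsto_measure_not_of_tendstoInMeasure
      (p := fun θ => ∀ x, ‖r x θ‖ ≤ R x * ‖θ - θ₀‖) hcons hbound
  have hlln : Tendsto (fun n => P {ω | κ - ∫ x, R x ∂ρ ≤ ‖empiricalMean X R n ω - ∫ x, R x ∂ρ‖})
      atTop (𝓝 0) := by
    have hconv := tendstoInMeasure_empiricalMean hlaw hindep hR
    rw [tendstoInMeasure_iff_norm] at hconv
    exact hconv (κ - ∫ x, R x ∂ρ) (sub_pos.2 hRκ)
  refine tendsto_measure_zero_of_subset_union hfar hlln fun n ω hω => ?_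
  by_contra hnot
  simp only [Set.mem_union, Set.mem_ofPred_eq, not_or, not_not, not_le, Real.norm_eq_abs]
    at hω hnot
  have hmean : empiricalMean X R n ω ≤ κ := by linarith [(abs_lt.1 hnot.2).2]
  exact hω.not_ge ((norm_empiricalMean_le hnot.1 n ω).trans
    (mul_le_mul_of_nonneg_right hmean (norm_nonneg _)))

variable [NormedSpace ℝ E] [FiniteDimensional ℝ E] [CompleteSpace F] [MeasurableSpace F]
  [BorelSpace F] [SecondCountableTopology F] {s : 𝓧 → E → F} {G : 𝓧 → ℝ} {L : F →L[ℝ] E}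

theorem isLittleOInProb_sub_empiricalMean_influence (hlaw : ∀ i, HasLaw (X i) ρ P)
    (hindep : Pairwise (Function.onFun (· ⟂ᵢ[P] ·) X))
    (hs : ∀ᶠ θ in 𝓝 θ₀, ∀ x, ContDiffAt ℝ 1 (s x) θ)
    (hm : ∀ᶠ θ in 𝓝 θ₀, Measurable fun x => s x θ) (hG : Integrable G ρ)
    (hle : ∀ᶠ θ in 𝓝 θ₀, ∀ x, ‖fderiv ℝ (s x) θ‖ ≤ G x)
    (hL : L ∘L ∫ x, fderiv ℝ (s x) θ₀ ∂ρ = -ContinuousLinearMap.id ℝ E)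
    (hcons : TendstoInMeasure P θhat atTop fun _ => θ₀)
    (hroot : Tendsto (fun n => P {ω | ∑ i ∈ Finset.range n, s (X i ω) (θhat n ω) ≠ 0})
      atTop (𝓝 0)) :
    IsLittleOInProb P
      (fun n ω => (θhat n ω - θ₀) - empiricalMean X (fun x => L (s x θ₀)) n ω)
      fun n ω => empiricalMean X (fun x => L (s x θ₀)) n ω := by
  have hd : ∀ᶠ θ in 𝓝 θ₀, ∀ x, DifferentiableAt ℝ (s x) θ :=
    hs.mono fun θ hθ x => (hθ x).differentiableAt one_ne_zero
  have hderiv_int : Integrable (fun x => fderiv ℝ (s x) θ₀) ρ :=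
    hG.mono' (stronglyMeasurable_fderiv_param hm hd.self_of_nhds).aestronglyMeasurable
      (.of_forall hle.self_of_nhds)
  have hrem := isLittleOInProb_empiricalMean hlaw hindep hcons
    (r := fun x θ => s x θ - s x θ₀ - fderiv ℝ (s x) θ₀ (θ - θ₀))
    fun ε hε => exists_integrable_linearization_bound hs hm hG hle hε
  have hderiv := isLittleOInProb_sub_apply
    (tendstoInMeasure_empiricalMean hlaw hindep hderiv_int) fun n ω => θhat n ω - θ₀
  refine ((hrem.add hderiv).of_tendsto_measure_norm_gt (c := ‖L‖ + 1) (by positivity)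
    (tendsto_measure_zero_of_subset hroot fun n ω hω hzero => ?_)).sub_right_of_sub_left
  rw [Set.mem_ofPred_eq, sub_empiricalMean_influence_eq hL (fun x => fderiv ℝ (s x) θ₀) hzero] at hω
  exact hω.not_ge ((L.le_opNorm _).trans
    (mul_le_mul_of_nonneg_right (by linarith) (norm_nonneg _)))

theorem tendstoInDistribution_sqrt_smul_root [IsProbabilityMeasure P] {ι : Type*} [Fintype ι]
    [DecidableEq ι] {θhat : ℕ → Ω → EuclideanSpace ℝ ι} {θ₀ : EuclideanSpace ℝ ι}
    {s : 𝓧 → EuclideanSpace ℝ ι → F} {L : F →L[ℝ] EuclideanSpace ℝ ι} {S : Matrix ι ι ℝ}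
    (hlaw : ∀ i, HasLaw (X i) ρ P) (hindep : iIndepFun X P)
    (hs : ∀ᶠ θ in 𝓝 θ₀, ∀ x, ContDiffAt ℝ 1 (s x) θ)
    (hm : ∀ᶠ θ in 𝓝 θ₀, Measurable fun x => s x θ) (hG : Integrable G ρ)
    (hle : ∀ᶠ θ in 𝓝 θ₀, ∀ x, ‖fderiv ℝ (s x) θ‖ ≤ G x)
    (hL : L ∘L ∫ x, fderiv ℝ (s x) θ₀ ∂ρ = -ContinuousLinearMap.id ℝ _)
    (hs₂ : MemLp (fun x => s x θ₀) 2 ρ) (hmean : ∫ x, s x θ₀ ∂ρ = 0) (hS : S.PosSemidef)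
    (hcov : ∀ t : EuclideanSpace ℝ ι, ∫ x, inner ℝ (L (s x θ₀)) t ^ 2 ∂ρ = t ⬝ᵥ S *ᵥ t)
    (hθhat : ∀ n, AEMeasurable (θhat n) P) (hcons : TendstoInMeasure P θhat atTop fun _ => θ₀)
    (hroot : Tendsto (fun n => P {ω | ∑ i ∈ Finset.range n, s (X i ω) (θhat n ω) ≠ 0})
      atTop (𝓝 0)) :
    TendstoInDistribution (fun (n : ℕ) ω => √(n : ℝ) • (θhat n ω - θ₀)) atTop id
      (fun _ => P) (multivariateGaussian 0 S) := by
  have : IsProbabilityMeasure ρ := (hlaw 0).isProbabilityMeasure_iff.1 ‹_›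
  have hmeanL : ∫ x, L (s x θ₀) ∂ρ = 0 := by
    rw [L.integral_comp_comm (hs₂.integrable one_le_two), hmean, map_zero]
  have hclt := tendstoInDistribution_sqrt_smul_empiricalMean hlaw hindep
    (L.comp_memLp' hs₂) hmeanL hS hcov
  obtain ⟨C, hC⟩ := exists_isBigOInProbWith_one_of_tendstoInDistribution hclt
  have hdiff := ((isLittleOInProb_sub_empiricalMean_influence hlaw
    (fun i j hij => hindep.indepFun hij) hs hm hG hle hL hcons hroot).smul
    fun n => √(n : ℝ)).tendstoInMeasure_zero hC
  simp only [smul_sub √_ (_ - _)] at hdiff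
  exact tendstoInDistribution_of_tendstoInMeasure_sub _ _ hclt hdiff
    fun n => ((hθhat n).sub_const θ₀).const_smul √(n : ℝ)

end ZEstimator

section PullOut

variable {𝓧 ι : Type*} [Fintype ι] {m₀ m₁ : MeasurableSpace 𝓧} {ρ : Measure[m₁] 𝓧}
  {w g : ι → 𝓧 → ℝ}

theorem condExp_sum_mul (hw : ∀ i, Measurable[m₀] (w i)) (hg : ∀ i, Integrable (g i) ρ)
    (hwg : Integrable (fun x => ∑ i, w i x * g i x) ρ) :
    ρ[fun x => ∑ i, w i x * g i x | m₀] =ᵐ[ρ] fun x => ∑ i, w i x * (ρ[g i | m₀]) x := by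
  let toVec (f : ι → 𝓧 → ℝ) (x : 𝓧) : EuclideanSpace ℝ ι := WithLp.toLp 2 fun i => f i x
  have hinner (f : ι → 𝓧 → ℝ) (x : 𝓧) : innerSL ℝ (toVec w x) (toVec f x) = ∑ i, w i x * f i x := by
    simp [toVec, PiLp.inner_apply, mul_comm]
  have hg_vec : Integrable (toVec g) ρ := Integrable.of_eval_piLp hg
  have hw_vec : StronglyMeasurable[m₀] (toVec w) :=
    ((WithLp.measurable_toLp 2 _).comp (@measurable_pi_lambda _ _ _ m₀ _ _ hw)).stronglyMeasurable
  have hpull := condExp_bilin_of_stronglyMeasurable_left (innerSL ℝ) hw_vec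
    (by simpa only [hinner] using hwg) hg_vec
  simp only [hinner] at hpull
  have hcoord (i : ι) : ∀ᵐ x ∂ρ, (ρ[toVec g | m₀]) x i = (ρ[g i | m₀]) x :=
    (EuclideanSpace.proj (𝕜 := ℝ) i).comp_condExp_comm hg_vec
  filter_upwards [hpull, ae_all_iff.2 hcoord] with x hx hi
  rw [hx, ← hinner]
  exact congrArg (innerSL ℝ (toVec w x)) (PiLp.ext hi)

variable [IsFiniteMeasure ρ]

theorem setIntegral_sum_mul_condExp (hm : m₀ ≤ m₁) (hw : ∀ i, Measurable[m₀] (w i))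
    (hg : ∀ i, Integrable (g i) ρ) {T : Set 𝓧} (hT : MeasurableSet[m₀] T)
    (hwg : IntegrableOn (fun x => ∑ i, w i x * g i x) T ρ) :
    ∫ x in T, ∑ i, w i x * (ρ[g i | m₀]) x ∂ρ = ∫ x in T, ∑ i, w i x * g i x ∂ρ := by
  have hind (f : ι → 𝓧 → ℝ) : (T.indicator fun x => ∑ i, w i x * f i x) =
      fun x => ∑ i, T.indicator (w i) x * f i x := by
    ext x; by_cases hx : x ∈ T <;> simp [hx]
  have hwgT : Integrable (fun x => ∑ i, T.indicator (w i) x * g i x) ρ :=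
    hind g ▸ hwg.integrable_indicator (hm _ hT)
  rw [← integral_indicator (hm _ hT), ← integral_indicator (hm _ hT), hind, hind,
    ← integral_congr_ae (condExp_sum_mul (fun i => (hw i).indicator hT) hg hwgT),
    integral_condExp hm]

theorem integral_sum_mul_condExp (hm : m₀ ≤ m₁) (hw : ∀ i, Measurable[m₀] (w i))
    (hg : ∀ i, Integrable (g i) ρ) (hwg : Integrable (fun x => ∑ i, w i x * g i x) ρ) :
    ∫ x, ∑ i, w i x * (ρ[g i | m₀]) x ∂ρ = ∫ x, ∑ i, w i x * g i x ∂ρ := by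
  rw [← integral_congr_ae (condExp_sum_mul hw hg hwg), integral_condExp hm]

theorem integrable_sum_mul_of_condExp (hm : m₀ ≤ m₁) (hw : ∀ i, Measurable[m₀] (w i))
    (hg : ∀ i, Integrable (g i) ρ) (hnonneg : ∀ x, 0 ≤ ∑ i, w i x * g i x)
    (hcond : Integrable (fun x => ∑ i, w i x * (ρ[g i | m₀]) x) ρ) :
    Integrable (fun x => ∑ i, w i x * g i x) ρ := by
  let T (N : ℕ) : Set 𝓧 := {x | ∀ i, ‖w i x‖ ≤ N}
  have hT (N : ℕ) : MeasurableSet[m₀] (T N) := by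
    simp only [T, Set.ofPred_forall]
    exact .iInter fun i => hw i (measurableSet_le measurable_norm measurable_const)
  have hcover : AECover ρ atTop T :=
    ⟨ae_of_all _ fun x => eventually_all.2 fun i =>
      tendsto_natCast_atTop_atTop.eventually_ge_atTop _, fun N => hm _ (hT N)⟩
  have hon (N : ℕ) : IntegrableOn (fun x => ∑ i, w i x * g i x) (T N) ρ :=
    integrable_finsetSum _ fun i _ => (hg i).integrableOn.bdd_mul (c := N)
      ((hw i).mono hm le_rfl).aestronglyMeasurable
      ((ae_restrict_iff' (hm _ (hT N))).2 (ae_of_all _ fun x hx => hx i))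
  refine hcover.integrable_of_integral_tendsto_of_nonneg_ae _ hon (ae_of_all _ hnonneg)
    ((hcover.integral_tendsto_of_countably_generated hcond).congr fun N => ?_)
  exact setIntegral_sum_mul_condExp hm hw hg (hT N) (hon N)

end PullOut

section QuadraticForm

variable {ι 𝓧 : Type*} [Fintype ι]

theorem dotProduct_mulVec_eq_sum_prod (u : ι → ℝ) (M : Matrix ι ι ℝ) :
    u ⬝ᵥ M *ᵥ u = ∑ q : ι × ι, u q.1 * u q.2 * M q.1 q.2 := by
  simp only [dotProduct, Matrix.mulVec, Finset.mul_sum, Fintype.sum_prod_type]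
  exact Finset.sum_congr rfl fun i _ => Finset.sum_congr rfl fun j _ => by ring

variable [MeasurableSpace 𝓧] {ρ : Measure 𝓧} {M : 𝓧 → Matrix ι ι ℝ}

theorem integrable_dotProduct_mulVec (hM : ∀ i j, Integrable (fun x => M x i j) ρ) (u : ι → ℝ) :
    Integrable (fun x => u ⬝ᵥ M x *ᵥ u) ρ := by
  simp only [dotProduct_mulVec_eq_sum_prod]
  exact integrable_finsetSum _ fun q _ => (hM q.1 q.2).const_mul _

theorem integral_dotProduct_mulVec (hM : ∀ i j, Integrable (fun x => M x i j) ρ) (u : ι → ℝ) :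
    ∫ x, u ⬝ᵥ M x *ᵥ u ∂ρ = u ⬝ᵥ (Matrix.of fun i j => ∫ x, M x i j ∂ρ) *ᵥ u := by
  simp only [dotProduct_mulVec_eq_sum_prod, Matrix.of_apply]
  rw [integral_finsetSum _ fun q _ => (hM q.1 q.2).const_mul _]
  exact Finset.sum_congr rfl fun q _ => integral_const_mul _ _

end QuadraticForm

namespace GEE

section Score

variable {𝓩 : Type*} {m p : ℕ}

/-- The matrix `D(z, θ)ᵀ W(z, θ)` by which the score multiplies the residual `y - μ(z, θ)`. -/
noncomputable def weightedJacobian (μ : 𝓩 → EuclideanSpace ℝ (Fin p) → EuclideanSpace ℝ (Fin m))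
    (W : 𝓩 → EuclideanSpace ℝ (Fin p) → Matrix (Fin m) (Fin m) ℝ)
    (z : 𝓩) (θ : EuclideanSpace ℝ (Fin p)) : Matrix (Fin p) (Fin m) ℝ :=
  (jacobian μ z θ)ᵀ * W z θ

theorem score_apply (μ : 𝓩 → EuclideanSpace ℝ (Fin p) → EuclideanSpace ℝ (Fin m))
    (W : 𝓩 → EuclideanSpace ℝ (Fin p) → Matrix (Fin m) (Fin m) ℝ)
    (x : 𝓩 × EuclideanSpace ℝ (Fin m)) (θ : EuclideanSpace ℝ (Fin p)) (a : Fin p) :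
    score μ W x θ a = ∑ j, weightedJacobian μ W x.1 θ a j * (x.2 j - μ x.1 θ j) := rfl

theorem inner_score (μ : 𝓩 → EuclideanSpace ℝ (Fin p) → EuclideanSpace ℝ (Fin m))
    (W : 𝓩 → EuclideanSpace ℝ (Fin p) → Matrix (Fin m) (Fin m) ℝ)
    (x : 𝓩 × EuclideanSpace ℝ (Fin m)) (θ u : EuclideanSpace ℝ (Fin p)) :
    inner ℝ (score μ W x θ) u =
      ∑ j, (u ᵥ* weightedJacobian μ W x.1 θ) j * (x.2 j - μ x.1 θ j) := by
  simp only [PiLp.inner_apply, score_apply, Matrix.vecMul, dotProduct, Finset.sum_mul,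
    RCLike.inner_apply, conj_trivial, Finset.mul_sum]
  rw [Finset.sum_comm]
  exact Finset.sum_congr rfl fun j _ => Finset.sum_congr rfl fun a _ => by ring

theorem inner_score_sq (μ : 𝓩 → EuclideanSpace ℝ (Fin p) → EuclideanSpace ℝ (Fin m))
    (W : 𝓩 → EuclideanSpace ℝ (Fin p) → Matrix (Fin m) (Fin m) ℝ)
    (x : 𝓩 × EuclideanSpace ℝ (Fin m)) (θ u : EuclideanSpace ℝ (Fin p)) :
    inner ℝ (score μ W x θ) u ^ 2 = ∑ q : Fin m × Fin m,
      (u ᵥ* weightedJacobian μ W x.1 θ) q.1 * (u ᵥ* weightedJacobian μ W x.1 θ) q.2 *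
        ((x.2 q.1 - μ x.1 θ q.1) * (x.2 q.2 - μ x.1 θ q.2)) := by
  rw [inner_score, sq, Finset.sum_mul_sum, Fintype.sum_prod_type]
  exact Finset.sum_congr rfl fun j _ => Finset.sum_congr rfl fun l _ => by ring

variable [MeasurableSpace 𝓩] {ρ : Measure (𝓩 × EuclideanSpace ℝ (Fin m))}
  {μ : 𝓩 → EuclideanSpace ℝ (Fin p) → EuclideanSpace ℝ (Fin m)}
  {W : 𝓩 → EuclideanSpace ℝ (Fin p) → Matrix (Fin m) (Fin m) ℝ}
  {θ₀ θ : EuclideanSpace ℝ (Fin p)} {U : Set (EuclideanSpace ℝ (Fin p))}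

theorem Regular.mem_nhds (hreg : Regular ρ μ W θ₀ U) : U ∈ 𝓝 θ₀ :=
  hreg.isOpen.mem_nhds hreg.mem

theorem Regular.differentiableAt_mean (hreg : Regular ρ μ W θ₀ U) (z : 𝓩) (hθ : θ ∈ U) :
    DifferentiableAt ℝ (μ z) θ :=
  ((hreg.contDiffOn_mean z).contDiffAt (hreg.isOpen.mem_nhds hθ)).differentiableAt two_ne_zero

theorem Regular.contDiffOn_jacobian (hreg : Regular ρ μ W θ₀ U) (z : 𝓩) (j : Fin m) (a : Fin p) :
    ContDiffOn ℝ 1 (fun θ => jacobian μ z θ j a) U :=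
  contDiffOn_euclidean.1 (((hreg.contDiffOn_mean z).fderiv_of_isOpen hreg.isOpen
    (by norm_num)).clm_apply contDiffOn_const) j

theorem Regular.contDiffOn_weightedJacobian (hreg : Regular ρ μ W θ₀ U) (z : 𝓩) (a : Fin p)
    (j : Fin m) : ContDiffOn ℝ 1 (fun θ => weightedJacobian μ W z θ a j) U := by
  simp only [weightedJacobian, Matrix.mul_apply, Matrix.transpose_apply]
  exact ContDiffOn.sum fun l _ =>
    (hreg.contDiffOn_jacobian z l a).mul (hreg.contDiffOn_weight z l j)

theorem Regular.contDiffOn_score (hreg : Regular ρ μ W θ₀ U)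
    (x : 𝓩 × EuclideanSpace ℝ (Fin m)) : ContDiffOn ℝ 1 (score μ W x) U := by
  refine contDiffOn_euclidean.2 fun a => ?_
  simp only [score_apply]
  refine ContDiffOn.sum fun j _ => (hreg.contDiffOn_weightedJacobian x.1 a j).mul ?_
  exact contDiffOn_const.sub
    (contDiffOn_euclidean.1 ((hreg.contDiffOn_mean x.1).of_le one_le_two) j)

theorem Regular.differentiableAt_weightedJacobian (hreg : Regular ρ μ W θ₀ U) (z : 𝓩) (a : Fin p)
    (j : Fin m) : DifferentiableAt ℝ (fun θ => weightedJacobian μ W z θ a j) θ₀ :=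
  ((hreg.contDiffOn_weightedJacobian z a j).contDiffAt hreg.mem_nhds).differentiableAt one_ne_zero

theorem Regular.differentiableAt_score (hreg : Regular ρ μ W θ₀ U)
    (x : 𝓩 × EuclideanSpace ℝ (Fin m)) : DifferentiableAt ℝ (score μ W x) θ₀ :=
  ((hreg.contDiffOn_score x).contDiffAt hreg.mem_nhds).differentiableAt one_ne_zero

theorem Regular.measurable_mean_apply (hreg : Regular ρ μ W θ₀ U) (hθ : θ ∈ U) (j : Fin m) :
    Measurable fun z => μ z θ j :=
  (EuclideanSpace.proj (𝕜 := ℝ) j).measurable.comp (hreg.measurable_mean θ hθ)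

theorem Regular.measurable_jacobian (hreg : Regular ρ μ W θ₀ U) (hθ : θ ∈ U) (j : Fin m)
    (a : Fin p) : Measurable fun z => jacobian μ z θ j a :=
  (EuclideanSpace.proj (𝕜 := ℝ) j).measurable.comp <| measurable_fderiv_apply_param
    (eventually_of_mem (hreg.isOpen.mem_nhds hθ) hreg.measurable_mean)
    (fun z => hreg.differentiableAt_mean z hθ) (EuclideanSpace.single a 1)

theorem Regular.measurable_weightedJacobian (hreg : Regular ρ μ W θ₀ U) (hθ : θ ∈ U) (a : Fin p)
    (j : Fin m) : Measurable fun z => weightedJacobian μ W z θ a j := by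
  simp only [weightedJacobian, Matrix.mul_apply, Matrix.transpose_apply]
  exact Finset.measurable_fun_sum _ fun l _ =>
    (hreg.measurable_jacobian hθ l a).mul (hreg.measurable_weight θ hθ l j)

theorem Regular.measurable_fderiv_weightedJacobian (hreg : Regular ρ μ W θ₀ U) (a : Fin p)
    (j : Fin m) (v : EuclideanSpace ℝ (Fin p)) :
    Measurable fun z => fderiv ℝ (fun θ => weightedJacobian μ W z θ a j) θ₀ v :=
  measurable_fderiv_apply_param
    (eventually_of_mem hreg.mem_nhds fun _ hθ => hreg.measurable_weightedJacobian hθ a j)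
    (fun z => hreg.differentiableAt_weightedJacobian z a j) v

theorem Regular.measurable_score (hreg : Regular ρ μ W θ₀ U) (hθ : θ ∈ U) :
    Measurable fun x => score μ W x θ := by
  refine (WithLp.measurable_toLp 2 _).comp (measurable_pi_lambda _ fun a => ?_)
  change Measurable fun x => score μ W x θ a
  simp only [score_apply]
  exact Finset.measurable_fun_sum _ fun j _ =>
    ((hreg.measurable_weightedJacobian hθ a j).comp measurable_fst).mul
      (((EuclideanSpace.proj (𝕜 := ℝ) j).measurable.comp measurable_snd).sub
        ((hreg.measurable_mean_apply hθ j).comp measurable_fst))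

theorem Regular.fderiv_score_apply (hreg : Regular ρ μ W θ₀ U)
    (x : 𝓩 × EuclideanSpace ℝ (Fin m)) (a b : Fin p) :
    fderiv ℝ (score μ W x) θ₀ (EuclideanSpace.single b 1) a =
      ∑ j, fderiv ℝ (fun θ => weightedJacobian μ W x.1 θ a j) θ₀ (EuclideanSpace.single b 1) *
        (x.2 j - μ x.1 θ₀ j) - breadIntegrand μ W θ₀ x a b := by
  have hμ (j : Fin m) : HasFDerivAt (fun θ => μ x.1 θ j) _ θ₀ :=
    (EuclideanSpace.proj (𝕜 := ℝ) j).hasFDerivAt.comp θ₀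
      (hreg.differentiableAt_mean x.1 hreg.mem).hasFDerivAt
  have hcomp : HasFDerivAt (fun θ => score μ W x θ a) _ θ₀ :=
    (EuclideanSpace.proj (𝕜 := ℝ) a).hasFDerivAt.comp θ₀ (hreg.differentiableAt_score x).hasFDerivAt
  have hsum : HasFDerivAt (fun θ => score μ W x θ a) _ θ₀ :=
    HasFDerivAt.fun_sum (u := Finset.univ) fun j _ =>
      (hreg.differentiableAt_weightedJacobian x.1 a j).hasFDerivAt.mul ((hμ j).const_sub (x.2 j))
  have hbread : breadIntegrand μ W θ₀ x a b = ∑ j, weightedJacobian μ W x.1 θ₀ a j *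
      fderiv ℝ (μ x.1) θ₀ (EuclideanSpace.single b 1) j := rfl
  refine (DFunLike.congr_fun (hcomp.unique hsum) (EuclideanSpace.single b 1)).trans ?_
  rw [hbread, ← Finset.sum_sub_distrib, sum_apply]
  refine Finset.sum_congr rfl fun j _ => ?_
  simp
  ring

end Score

section Moments

variable {𝓩 : Type*} [MeasurableSpace 𝓩] {m p : ℕ}
  {ρ : Measure (𝓩 × EuclideanSpace ℝ (Fin m))}
  {μ : 𝓩 → EuclideanSpace ℝ (Fin p) → EuclideanSpace ℝ (Fin m)}
  {W : 𝓩 → EuclideanSpace ℝ (Fin p) → Matrix (Fin m) (Fin m) ℝ}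
  {θ₀ : EuclideanSpace ℝ (Fin p)} {U : Set (EuclideanSpace ℝ (Fin p))}

theorem measurable_comp_fst_comap {𝓨 : Type*} {f : 𝓩 → ℝ} (hf : Measurable f) :
    Measurable[MeasurableSpace.comap Prod.fst inferInstance] fun x : 𝓩 × 𝓨 => f x.1 :=
  hf.comp (comap_measurable _)

theorem Regular.isHermitian_J (hreg : Regular ρ μ W θ₀ U) : (J ρ μ W θ₀).IsHermitian := by
  have hbread (x : 𝓩 × EuclideanSpace ℝ (Fin m)) : (breadIntegrand μ W θ₀ x).IsSymm := by
    simp [Matrix.IsSymm, breadIntegrand, Matrix.transpose_mul,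
      (hreg.symm_weight x.1 θ₀ hreg.mem).eq, Matrix.mul_assoc]
  ext a b
  simp [J, (hbread _).apply a b]

theorem Regular.meatIntegrand_eq (hreg : Regular ρ μ W θ₀ U)
    (x : 𝓩 × EuclideanSpace ℝ (Fin m)) :
    meatIntegrand ρ μ W θ₀ x =
      weightedJacobian μ W x.1 θ₀ * trueCov ρ x * (weightedJacobian μ W x.1 θ₀)ᵀ := by
  rw [weightedJacobian, Matrix.transpose_mul, Matrix.transpose_transpose,
    (hreg.symm_weight x.1 θ₀ hreg.mem).eq, meatIntegrand]
  simp only [Matrix.mul_assoc]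

theorem Regular.isHermitian_K (hreg : Regular ρ μ W θ₀ U) : (K ρ μ W θ₀).IsHermitian := by
  have hcov (x : 𝓩 × EuclideanSpace ℝ (Fin m)) : (trueCov ρ x)ᵀ = trueCov ρ x := by
    ext j l
    simp [trueCov, mul_comm]
  have hmeat (x : 𝓩 × EuclideanSpace ℝ (Fin m)) : (meatIntegrand ρ μ W θ₀ x).IsSymm := by
    rw [Matrix.IsSymm, hreg.meatIntegrand_eq, Matrix.transpose_mul, Matrix.transpose_mul, hcov,
      Matrix.transpose_transpose, Matrix.mul_assoc]
  ext a b
  simp [K, (hmeat _).apply a b]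

theorem Regular.memLp_residual (hreg : Regular ρ μ W θ₀ U) (j : Fin m) :
    MemLp (fun x : 𝓩 × EuclideanSpace ℝ (Fin m) => x.2 j - μ x.1 θ₀ j) 2 ρ :=
  (hreg.memLp.eval_piLp j).sub
    (((hreg.memLp.eval_piLp j).condExp one_le_two).ae_eq (hreg.mean j))

theorem Regular.trueCov_ae_eq (hreg : Regular ρ μ W θ₀ U) (j l : Fin m) :
    (fun x => trueCov ρ x j l) =ᵐ[ρ]
      condZ ρ fun x => (x.2 j - μ x.1 θ₀ j) * (x.2 l - μ x.1 θ₀ l) := by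
  refine condExp_congr_ae ?_
  filter_upwards [hreg.mean j, hreg.mean l] with x hj hl
  rw [hj, hl]

theorem Regular.sum_mul_condZ_residual_ae_eq (hreg : Regular ρ μ W θ₀ U)
    (u : EuclideanSpace ℝ (Fin p)) :
    (fun x => ∑ q : Fin m × Fin m,
      (u ᵥ* weightedJacobian μ W x.1 θ₀) q.1 * (u ᵥ* weightedJacobian μ W x.1 θ₀) q.2 *
        condZ ρ (fun x => (x.2 q.1 - μ x.1 θ₀ q.1) * (x.2 q.2 - μ x.1 θ₀ q.2)) x) =ᵐ[ρ]
      fun x => u ⬝ᵥ meatIntegrand ρ μ W θ₀ x *ᵥ u := by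
  filter_upwards [ae_all_iff.2 fun q : Fin m × Fin m => hreg.trueCov_ae_eq q.1 q.2] with x hx
  rw [hreg.meatIntegrand_eq, ← Matrix.mulVec_mulVec, ← Matrix.mulVec_mulVec,
    Matrix.dotProduct_mulVec, Matrix.mulVec_transpose, dotProduct_mulVec_eq_sum_prod]
  exact Finset.sum_congr rfl fun q _ => by rw [hx q]

theorem Regular.measurable_vecMul_weightedJacobian_mul (hreg : Regular ρ μ W θ₀ U)
    (u : EuclideanSpace ℝ (Fin p)) (q : Fin m × Fin m) :
    Measurable fun z =>
      (u ᵥ* weightedJacobian μ W z θ₀) q.1 * (u ᵥ* weightedJacobian μ W z θ₀) q.2 := by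
  have hu (j : Fin m) : Measurable fun z => (u ᵥ* weightedJacobian μ W z θ₀) j := by
    simp only [Matrix.vecMul, dotProduct]
    exact Finset.measurable_fun_sum _ fun a _ =>
      (hreg.measurable_weightedJacobian hreg.mem a j).const_mul _
  exact (hu q.1).mul (hu q.2)

theorem Regular.integrable_fderiv_score (hreg : Regular ρ μ W θ₀ U) :
    Integrable (fun x => fderiv ℝ (score μ W x) θ₀) ρ := by
  obtain ⟨G, hG, hle⟩ := hreg.dominated
  exact hG.mono' (stronglyMeasurable_fderiv_param
    (eventually_of_mem hreg.mem_nhds fun _ hθ => hreg.measurable_score hθ)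
    hreg.differentiableAt_score).aestronglyMeasurable (ae_of_all _ fun x => hle x θ₀ hreg.mem)

variable [IsFiniteMeasure ρ]

theorem Regular.condZ_residual (hreg : Regular ρ μ W θ₀ U) (j : Fin m) :
    condZ ρ (fun x => x.2 j - μ x.1 θ₀ j) =ᵐ[ρ] 0 := by
  have hY : Integrable (fun x : 𝓩 × EuclideanSpace ℝ (Fin m) => x.2 j) ρ :=
    (hreg.memLp.eval_piLp j).integrable one_le_two
  have hμ : Integrable (fun x : 𝓩 × EuclideanSpace ℝ (Fin m) => μ x.1 θ₀ j) ρ :=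
    integrable_condExp.congr (hreg.mean j)
  have hμ_condZ : condZ ρ (fun x => μ x.1 θ₀ j) = fun x => μ x.1 θ₀ j :=
    condExp_of_stronglyMeasurable measurable_fst.comap_le
      (measurable_comp_fst_comap (hreg.measurable_mean_apply hreg.mem j)).stronglyMeasurable hμ
  exact (condExp_sub hY hμ _).trans <|
    ((hreg.mean j).sub (EventuallyEq.of_eq hμ_condZ)).trans (EventuallyEq.of_eq (sub_self _))

theorem Regular.integral_sum_mul_residual_eq_zero (hreg : Regular ρ μ W θ₀ U) {f : Fin m → 𝓩 → ℝ}
    (hf : ∀ j, Measurable (f j))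
    (hint : Integrable (fun x => ∑ j, f j x.1 * (x.2 j - μ x.1 θ₀ j)) ρ) :
    ∫ x, ∑ j, f j x.1 * (x.2 j - μ x.1 θ₀ j) ∂ρ = 0 := by
  rw [← integral_sum_mul_condExp measurable_fst.comap_le
    (fun j => measurable_comp_fst_comap (hf j))
    (fun j => (hreg.memLp_residual j).integrable one_le_two) hint]
  refine integral_eq_zero_of_ae ?_
  filter_upwards [ae_all_iff.2 hreg.condZ_residual] with x hx
  exact Finset.sum_eq_zero fun j _ => mul_eq_zero_of_right _ (hx j)

theorem Regular.integral_fderiv_score_apply (hreg : Regular ρ μ W θ₀ U) (a b : Fin p) :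
    (∫ x, fderiv ℝ (score μ W x) θ₀ ∂ρ) (EuclideanSpace.single b 1) a = -J ρ μ W θ₀ a b := by
  have hint := hreg.integrable_fderiv_score
  have hint_apply (i : Fin p) := (hint.apply_continuousLinearMap
    (EuclideanSpace.single b (1 : ℝ))).eval_piLp i
  have hres : Integrable (fun x : 𝓩 × EuclideanSpace ℝ (Fin m) =>
      ∑ j, fderiv ℝ (fun θ => weightedJacobian μ W x.1 θ a j) θ₀ (EuclideanSpace.single b 1) *
        (x.2 j - μ x.1 θ₀ j)) ρ := by
    refine ((hint_apply a).add (hreg.integrable_J a b)).congr (ae_of_all _ fun x => ?_)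
    simp only [Pi.add_apply, hreg.fderiv_score_apply, sub_add_cancel]
  rw [ContinuousLinearMap.integral_apply hint, eval_integral_piLp hint_apply]
  simp only [hreg.fderiv_score_apply]
  rw [integral_sub hres (hreg.integrable_J a b), hreg.integral_sum_mul_residual_eq_zero
    (fun j => hreg.measurable_fderiv_weightedJacobian a j _) hres, zero_sub]
  rfl

theorem Regular.integral_fderiv_score (hreg : Regular ρ μ W θ₀ U) :
    ∫ x, fderiv ℝ (score μ W x) θ₀ ∂ρ = -Matrix.toEuclideanCLM (𝕜 := ℝ) (J ρ μ W θ₀) := by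
  refine ContinuousLinearMap.coe_injective
    ((EuclideanSpace.basisFun (Fin p) ℝ).toBasis.ext fun b => PiLp.ext fun a => ?_)
  simp [hreg.integral_fderiv_score_apply a b]

theorem Regular.integrable_inner_score_sq (hreg : Regular ρ μ W θ₀ U)
    (u : EuclideanSpace ℝ (Fin p)) :
    Integrable (fun x => inner ℝ (score μ W x θ₀) u ^ 2) ρ := by
  simp only [inner_score_sq]
  refine integrable_sum_mul_of_condExp measurable_fst.comap_le
    (fun q => measurable_comp_fst_comap (hreg.measurable_vecMul_weightedJacobian_mul u q))
    (fun q => (hreg.memLp_residual q.1).integrable_mul (hreg.memLp_residual q.2)) (fun x => ?_)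
    ((integrable_dotProduct_mulVec hreg.integrable_K u).congr
      (hreg.sum_mul_condZ_residual_ae_eq u).symm)
  exact (sq_nonneg _).trans_eq (inner_score_sq μ W x θ₀ u)

theorem Regular.integral_inner_score_sq (hreg : Regular ρ μ W θ₀ U)
    (u : EuclideanSpace ℝ (Fin p)) :
    ∫ x, inner ℝ (score μ W x θ₀) u ^ 2 ∂ρ = u ⬝ᵥ K ρ μ W θ₀ *ᵥ u := by
  have hint := hreg.integrable_inner_score_sq u
  simp only [inner_score_sq] at hint ⊢
  refine (integral_sum_mul_condExp measurable_fst.comap_le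
    (fun q => measurable_comp_fst_comap (hreg.measurable_vecMul_weightedJacobian_mul u q))
    (fun q => (hreg.memLp_residual q.1).integrable_mul (hreg.memLp_residual q.2))
    hint).symm.trans ?_
  exact (integral_congr_ae (hreg.sum_mul_condZ_residual_ae_eq u)).trans
    (integral_dotProduct_mulVec hreg.integrable_K u)

theorem Regular.memLp_score (hreg : Regular ρ μ W θ₀ U) :
    MemLp (fun x => score μ W x θ₀) 2 ρ := by
  refine MemLp.of_eval_piLp fun a => (memLp_two_iff_integrable_sq ?_).2 ?_
  · exact ((EuclideanSpace.proj (𝕜 := ℝ) a).measurable.comp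
      (hreg.measurable_score hreg.mem)).aestronglyMeasurable
  · simpa [EuclideanSpace.inner_single_right] using
      hreg.integrable_inner_score_sq (EuclideanSpace.single a 1)

theorem Regular.integral_score_eq_zero (hreg : Regular ρ μ W θ₀ U) :
    ∫ x, score μ W x θ₀ ∂ρ = 0 := by
  have hint (a : Fin p) := (hreg.memLp_score.eval_piLp a).integrable one_le_two
  refine PiLp.ext fun a => ?_
  rw [eval_integral_piLp hint]
  exact hreg.integral_sum_mul_residual_eq_zero
    (fun j => hreg.measurable_weightedJacobian hreg.mem a j) (hint a)

theorem Regular.posSemidef_K (hreg : Regular ρ μ W θ₀ U) : (K ρ μ W θ₀).PosSemidef := by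
  refine Matrix.PosSemidef.of_dotProduct_mulVec_nonneg hreg.isHermitian_K fun u => ?_
  rw [star_trivial, ← hreg.integral_inner_score_sq (WithLp.toLp 2 u)]
  exact integral_nonneg fun x => sq_nonneg _

theorem Regular.posSemidef_sandwich (hreg : Regular ρ μ W θ₀ U) :
    ((J ρ μ W θ₀)⁻¹ * K ρ μ W θ₀ * (J ρ μ W θ₀)⁻¹).PosSemidef := by
  have h := hreg.posSemidef_K.mul_mul_conjTranspose_same (J ρ μ W θ₀)⁻¹
  rwa [hreg.isHermitian_J.inv.eq] at h

theorem Regular.integral_inner_influence_sq (hreg : Regular ρ μ W θ₀ U)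
    (t : EuclideanSpace ℝ (Fin p)) :
    ∫ x, inner ℝ (Matrix.toEuclideanCLM (𝕜 := ℝ) (J ρ μ W θ₀)⁻¹ (score μ W x θ₀)) t ^ 2 ∂ρ =
      t ⬝ᵥ ((J ρ μ W θ₀)⁻¹ * K ρ μ W θ₀ * (J ρ μ W θ₀)⁻¹) *ᵥ t := by
  have hsymm : ((J ρ μ W θ₀)⁻¹)ᵀ = (J ρ μ W θ₀)⁻¹ := hreg.isHermitian_J.inv
  have hadj (v : EuclideanSpace ℝ (Fin p)) :
      inner ℝ (Matrix.toEuclideanCLM (𝕜 := ℝ) (J ρ μ W θ₀)⁻¹ v) t =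
        inner ℝ v (Matrix.toEuclideanCLM (𝕜 := ℝ) (J ρ μ W θ₀)⁻¹ t) := by
    rw [← ContinuousLinearMap.adjoint_inner_right, ← ContinuousLinearMap.star_eq_adjoint,
      ← map_star, Matrix.star_eq_conjTranspose, hreg.isHermitian_J.inv.eq]
  simp only [hadj]
  rw [hreg.integral_inner_score_sq, Matrix.ofLp_toEuclideanCLM, ← Matrix.mulVec_mulVec,
    ← Matrix.mulVec_mulVec, Matrix.dotProduct_mulVec (t : Fin p → ℝ), ← Matrix.mulVec_transpose,
    hsymm]

end Moments

section Root

variable {Ω 𝓩 : Type*} [MeasurableSpace Ω] [MeasurableSpace 𝓩] {m p : ℕ}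
  {P : Measure Ω} [IsProbabilityMeasure P] {ρ : Measure (𝓩 × EuclideanSpace ℝ (Fin m))}
  {μ : 𝓩 → EuclideanSpace ℝ (Fin p) → EuclideanSpace ℝ (Fin m)}
  {W : 𝓩 → EuclideanSpace ℝ (Fin p) → Matrix (Fin m) (Fin m) ℝ}
  {θ₀ : EuclideanSpace ℝ (Fin p)} {U : Set (EuclideanSpace ℝ (Fin p))}

theorem Regular.tendstoInDistribution_root (hreg : Regular ρ μ W θ₀ U)
    {X : ℕ → Ω → 𝓩 × EuclideanSpace ℝ (Fin m)} (hlaw : ∀ i, HasLaw (X i) ρ P)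
    (hindep : iIndepFun X P) (hJ : 0 < lambdaMin (J ρ μ W θ₀))
    {θhat : ℕ → Ω → EuclideanSpace ℝ (Fin p)} (hmeas : ∀ n, AEMeasurable (θhat n) P)
    (hroot : Tendsto
      (fun n : ℕ => P {ω | ∑ i ∈ Finset.range n, score μ W (X i ω) (θhat n ω) ≠ 0}) atTop (𝓝 0))
    (hcons : TendstoInMeasure P θhat atTop (fun _ => θ₀)) :
    TendstoInDistribution (fun (n : ℕ) ω => √(n : ℝ) • (θhat n ω - θ₀)) atTop id (fun _ => P)
      (multivariateGaussian 0 ((J ρ μ W θ₀)⁻¹ * K ρ μ W θ₀ * (J ρ μ W θ₀)⁻¹)) := by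
  have : IsProbabilityMeasure ρ := (hlaw 0).isProbabilityMeasure_iff.1 ‹_›
  obtain ⟨G, hG, hle⟩ := hreg.dominated
  have hinv : (J ρ μ W θ₀)⁻¹ * J ρ μ W θ₀ = 1 :=
    Matrix.nonsing_inv_mul _ (posDef_of_lambdaMin_pos hreg.isHermitian_J hJ).det_pos.ne'.isUnit
  have hL : Matrix.toEuclideanCLM (𝕜 := ℝ) (J ρ μ W θ₀)⁻¹ ∘L
      ∫ x, fderiv ℝ (score μ W x) θ₀ ∂ρ = -ContinuousLinearMap.id ℝ _ := by
    rw [hreg.integral_fderiv_score, ContinuousLinearMap.comp_neg, ← ContinuousLinearMap.mul_def,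
      ← map_mul, hinv, map_one, ContinuousLinearMap.one_def]
  exact tendstoInDistribution_sqrt_smul_root hlaw hindep
    (eventually_of_mem hreg.mem_nhds fun _ hθ x =>
      (hreg.contDiffOn_score x).contDiffAt (hreg.isOpen.mem_nhds hθ))
    (eventually_of_mem hreg.mem_nhds fun _ hθ => hreg.measurable_score hθ) hG
    (eventually_of_mem hreg.mem_nhds fun θ hθ x => hle x θ hθ) hL hreg.memLp_score
    hreg.integral_score_eq_zero hreg.posSemidef_sandwich hreg.integral_inner_influence_sq
    hmeas hcons hroot

end Root

end GEE

section Rates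

variable {Ω E : Type*} [MeasurableSpace Ω] [NormedAddCommGroup E] {P : Measure Ω}
  {X : ℕ → Ω → E} {C : ℝ → ℝ}

theorem IsBigOInProbWith.mono {r r' : ℕ → ℝ} (h : IsBigOInProbWith C P X r)
    (hC : ∀ ε, 0 ≤ C ε) (hr : ∀ n, r n ≤ r' n) : IsBigOInProbWith C P X r' := fun ε hε => by
  filter_upwards [h ε hε] with n hn
  exact (measure_mono fun ω hω =>
    (mul_le_mul_of_nonneg_left (hr n) (hC ε)).trans_lt hω).trans hn

theorem isBigOInProbWith_sqrt_log_div [NormedSpace ℝ E]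
    (h : IsBigOInProbWith C P (fun n ω => √(n : ℝ) • X n ω) fun _ => 1) {c : ℝ} (hc : 0 < c) :
    IsBigOInProbWith (fun _ => 1) P X fun n => √(Real.log n / (n * c)) := by
  intro ε hε
  have hlog : ∀ᶠ n : ℕ in atTop, C ε ^ 2 * c ≤ Real.log n :=
    (Real.tendsto_log_atTop.comp tendsto_natCast_atTop_atTop).eventually_ge_atTop _
  filter_upwards [h ε hε, hlog, eventually_gt_atTop 0] with n hP hn hn0
  refine (measure_mono fun ω hω => ?_).trans hP
  have hn0 : (0 : ℝ) < n := Nat.cast_pos.2 hn0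
  have hrate : √(n : ℝ) * √(Real.log n / (n * c)) = √(Real.log n / c) := by
    rw [← Real.sqrt_mul hn0.le]
    congr 1
    field_simp
  rw [Set.mem_ofPred_eq, one_mul] at hω
  calc C ε * 1 ≤ √(Real.log n / c) := by
        rw [mul_one]
        exact Real.le_sqrt_of_sq_le ((le_div_iff₀ hc).2 hn)
    _ = √(n : ℝ) * √(Real.log n / (n * c)) := hrate.symm
    _ < √(n : ℝ) * ‖X n ω‖ := by gcongr
    _ = ‖√(n : ℝ) • X n ω‖ := by rw [norm_smul, Real.norm_of_nonneg (Real.sqrt_nonneg _)]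

theorem sqrt_div_le_rpow_mul_sqrt_div {a l l' x n : ℝ} (hx : 0 ≤ x) (ha : 0 < a) (hl' : 0 < l')
    (h : a * l' ≤ l) (hn : 0 ≤ n) :
    √(x / (n * l)) ≤ a ^ (-(1 / 2) : ℝ) * √(x / (n * l')) := by
  have hrpow : a ^ (-(1 / 2) : ℝ) = √(a⁻¹) := by
    rw [Real.rpow_neg ha.le, ← Real.sqrt_eq_rpow, Real.sqrt_inv]
  rw [hrpow, ← Real.sqrt_mul (inv_nonneg.2 ha.le)]
  refine Real.sqrt_le_sqrt ?_
  rcases hn.eq_or_lt with rfl | hn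
  · simp
  · calc x / (n * l) ≤ x / (n * (a * l')) := by gcongr
      _ = a⁻¹ * (x / (n * l')) := by field_simp

end Rates

theorem mainTheorem8_general
    {Ω 𝓩 : Type*} [MeasurableSpace Ω] [MeasurableSpace 𝓩] {m p : ℕ}
    (P : Measure Ω) [IsProbabilityMeasure P]
    (ρ : Measure (𝓩 × EuclideanSpace ℝ (Fin m)))
    (μ : 𝓩 → EuclideanSpace ℝ (Fin p) → EuclideanSpace ℝ (Fin m))
    (W : 𝓩 → EuclideanSpace ℝ (Fin p) → Matrix (Fin m) (Fin m) ℝ)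
    (θ₀ : EuclideanSpace ℝ (Fin p)) (U : Set (EuclideanSpace ℝ (Fin p)))
    (hreg : GEE.Regular ρ μ W θ₀ U)
    (X : ℕ → Ω → 𝓩 × EuclideanSpace ℝ (Fin m))
    (hlaw : ∀ i, HasLaw (X i) ρ P) (hindep : iIndepFun X P)
    (hJ : 0 < lambdaMin (GEE.J ρ μ W θ₀))
    (θhat : ℕ → Ω → EuclideanSpace ℝ (Fin p)) (hmeas : ∀ n, AEMeasurable (θhat n) P)
    (hroot : Tendsto
      (fun n : ℕ => P {ω | ∑ i ∈ Finset.range n, GEE.score μ W (X i ω) (θhat n ω) ≠ 0})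
      atTop (𝓝 0))
    (hcons : TendstoInMeasure P θhat atTop (fun _ => θ₀)) :
    (IsBigOInProbWith (fun _ => 1) P (fun n ω => θhat n ω - θ₀)
        (fun n => √(Real.log n / (n * lambdaMin (GEE.J ρ μ W θ₀)))) ∧
      ∀ (H : Matrix (Fin p) (Fin p) ℝ) (a : ℝ), H.PosDef → 0 < a →
        (GEE.J ρ μ W θ₀ - a • H).PosSemidef →
        (∀ n : ℕ, √(Real.log n / (n * lambdaMin (GEE.J ρ μ W θ₀))) ≤
          a ^ (-(1 / 2) : ℝ) * √(Real.log n / (n * lambdaMin H))) ∧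
        IsBigOInProbWith (fun _ => 1) P (fun n ω => θhat n ω - θ₀)
          (fun n => a ^ (-(1 / 2) : ℝ) * √(Real.log n / (n * lambdaMin H)))) ∧
    ((GEE.J ρ μ W θ₀)⁻¹ * GEE.K ρ μ W θ₀ * (GEE.J ρ μ W θ₀)⁻¹).PosSemidef ∧
    TendstoInDistribution (fun (n : ℕ) ω => √(n : ℝ) • (θhat n ω - θ₀)) atTop id
      (fun _ => P)
      (multivariateGaussian 0
        ((GEE.J ρ μ W θ₀)⁻¹ * GEE.K ρ μ W θ₀ * (GEE.J ρ μ W θ₀)⁻¹)) := by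
  have : IsProbabilityMeasure ρ := (hlaw 0).isProbabilityMeasure_iff.1 ‹_›
  have hnormal := hreg.tendstoInDistribution_root hlaw hindep hJ hmeas hroot hcons
  obtain ⟨C, htight⟩ := exists_isBigOInProbWith_one_of_tendstoInDistribution hnormal
  have hrate := isBigOInProbWith_sqrt_log_div htight hJ
  refine ⟨⟨hrate, fun H a hH ha hlower => ?_⟩, hreg.posSemidef_sandwich, hnormal⟩
  have hp := pos_of_lambdaMin_pos hJ
  have hle (n : ℕ) := sqrt_div_le_rpow_mul_sqrt_div (Real.log_natCast_nonneg n) ha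
    (lambdaMin_pos hp hH)
    (mul_lambdaMin_le_of_posSemidef_sub hp hreg.isHermitian_J hH.1 ha.le hlower) n.cast_nonneg
  exact ⟨hle, hrate.mono (fun _ => zero_le_one) hle⟩

theorem mainTheorem8
    {Ω 𝓩 : Type*} [MeasurableSpace Ω] [MeasurableSpace 𝓩] {m p : ℕ}
    (P : Measure Ω) [IsProbabilityMeasure P]
    (ρ : Measure (𝓩 × EuclideanSpace ℝ (Fin m))) [IsProbabilityMeasure ρ]
    (μ : 𝓩 → EuclideanSpace ℝ (Fin p) → EuclideanSpace ℝ (Fin m))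
    (W : 𝓩 → EuclideanSpace ℝ (Fin p) → Matrix (Fin m) (Fin m) ℝ)
    (θ₀ : EuclideanSpace ℝ (Fin p)) (U : Set (EuclideanSpace ℝ (Fin p)))
    (hreg : GEE.Regular ρ μ W θ₀ U)
    -- the clusters `X i = (Z i, Y i)` are independent with law `ρ`
    (X : ℕ → Ω → 𝓩 × EuclideanSpace ℝ (Fin m))
    (hlaw : ∀ i, HasLaw (X i) ρ P) (hindep : iIndepFun X P)
    -- `θ₀` solves the population estimating equation
    (hpop : ∫ x, GEE.score μ W x θ₀ ∂ρ = 0)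
    (hJ : 0 < lambdaMin (GEE.J ρ μ W θ₀))
    -- `θhat` is a consistent root
    (θhat : ℕ → Ω → EuclideanSpace ℝ (Fin p)) (hmeas : ∀ n, AEMeasurable (θhat n) P)
    (hroot : Tendsto
      (fun n : ℕ => P {ω | ∑ i ∈ Finset.range n, GEE.score μ W (X i ω) (θhat n ω) ≠ 0})
      atTop (𝓝 0))
    (hcons : TendstoInMeasure P θhat atTop (fun _ => θ₀)) :
    (∃ C : ℝ → ℝ,
      IsBigOInProbWith C P (fun n ω => θhat n ω - θ₀)
        (fun n => √(Real.log n / (n * lambdaMin (GEE.J ρ μ W θ₀)))) ∧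
      ∀ (k d : ℕ) (Q : Fin k → ℝ) (h : Fin k → EuclideanSpace ℝ (Fin d))
        (α : EuclideanSpace ℝ (Fin p) → EuclideanSpace ℝ (Fin d)) (Pstar : Fin k → ℝ)
        (V : OrthonormalBasis (Fin p) ℝ (InfoGeom.tangent h)) (a b : ℝ),
        (∀ x, 0 < Q x) → ∑ x, Q x = 1 → InfoGeom.IsInfoProjection Q h (α θ₀) Pstar →
        0 < a →
        (GEE.J ρ μ W θ₀ - a • InfoGeom.hessian V Pstar).PosSemidef →
        (b • InfoGeom.hessian V Pstar - GEE.J ρ μ W θ₀).PosSemidef →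
        (∀ n : ℕ, √(Real.log n / (n * lambdaMin (GEE.J ρ μ W θ₀))) ≤
          a ^ (-(1 / 2) : ℝ) *
            √(Real.log n / (n * lambdaMin (InfoGeom.hessian V Pstar)))) ∧
        IsBigOInProbWith C P (fun n ω => θhat n ω - θ₀)
          (fun n => a ^ (-(1 / 2) : ℝ) *
            √(Real.log n / (n * lambdaMin (InfoGeom.hessian V Pstar))))) ∧
    ((GEE.J ρ μ W θ₀)⁻¹ * GEE.K ρ μ W θ₀ * (GEE.J ρ μ W θ₀)⁻¹).PosSemidef ∧
    TendstoInDistribution (fun (n : ℕ) ω => √(n : ℝ) • (θhat n ω - θ₀)) atTop id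
      (fun _ => P)
      (multivariateGaussian 0
        ((GEE.J ρ μ W θ₀)⁻¹ * GEE.K ρ μ W θ₀ * (GEE.J ρ μ W θ₀)⁻¹)) := by
  obtain ⟨⟨hrate, hcompare⟩, hsandwich⟩ :=
    mainTheorem8_general P ρ μ W θ₀ U hreg X hlaw hindep hJ θhat hmeas hroot hcons
  exact ⟨⟨fun _ => 1, hrate, fun _ _ _ _ _ _ V a _ _ _ hproj ha hlower _ =>
    hcompare _ a (InfoGeom.hessian_posDef V hproj.1.1) ha hlower⟩, hsandwich⟩
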